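/- Consider a two-receiver discrete memoryless broadcast channel with finite input alphabet $\mathcal X$, finite output alphabets $\mathcal Y_1,\mathcal Y_2$ and transition probabilities $p(y_1,y_2\mid x)$, used with private messages only. A pair $(R_1,R_2)$ with $R_1,R_2\ge 0$ is achievable if there are codes of length $n=0,1,2,\dots$ with $\lceil e^{nR_1}\rceil$ messages for receiver 1 and $\lceil e^{nR_2}\rceil$ messages for receiver 2, each consisting of an encoder of the message pair and one decoder per receiver, whose average probability of error (for independent uniform messages, an error being that at least one receiver decodes its own message wrongly) tends to $0$ as $n\to\infty$. The capacity region is the closure in $\mathbb R^2$ of the set of achievable pairs. Mutual informations are in nats and take values in $[0,\infty]$: $I(A;B\mid C)$ is the relative entropy of $P_{ABC}$ with respect to $P_C\,P_{A|C}\,P_{B|C}$. Then for every pair $(R_1,R_2)$ in the capacity region there are random variables $U,V,W_1,W_2$ (real-valued, which covers all standard Borel and in particular all discrete alphabets), $X\in\mathcal X$, $Y_1\in\mathcal Y_1$, $Y_2\in\mathcal Y_2$ on a common probability space such that $(U,V,W_1,W_2)\to X\to(Y_1,Y_2)$ is a Markov chain, the conditional distribution of $(Y_1,Y_2)$ given $X$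 is $p(y_1,y_2\mid x)$, $U$ and $V$ are independent, \begin{align*} I(U;Y_1|W_1) &= I(U;Y_1|V,W_1),\\ I(V;Y_2|W_2) &= I(V;Y_2|U,W_2),\\ I(U;V|W_1,W_2,Y_1) &= I(U;V|W_1,W_2,Y_2),\\ I(W_2;Y_1|W_1) &= I(W_1;Y_2|W_2),\\ I(W_2;Y_1|U,W_1) &= I(W_1;Y_2|U,W_2),\\ I(W_2;Y_1|V,W_1) &= I(W_1;Y_2|V,W_2),\\ I(W_2;Y_1|U,V,W_1) &= I(W_1;Y_2|U,V,W_2), \end{align*} and \[ R_1\le I(U;Y_1|W_1),\qquad R_2\le I(V;Y_2|W_2). \] Moreover, the third equality also holds in the difference form $I(U;Y_1|V,W_1,W_2)-I(U;Y_1|W_1,W_2)=I(U;Y_2|V,W_1,W_2)-I(U;Y_2|W_1,W_2)$, which keeps its content when both of its sides are infinite. -/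

import Mathlib

open MeasureTheory ProbabilityTheory Filter Topology

noncomputable section

namespace BroadcastChannel

/-! ### The two-receiver discrete memoryless broadcast channel -/

section Channel

variable {𝒳 𝒴₁ 𝒴₂ : Type*}

/-- A code of length `n` for a two-receiver broadcast channel with private messages only:
`M₁` messages for the first receiver, `M₂` messages for the second one, an encoder that sees both
messages, and one decoder per receiver, which sees only the output of this receiver. -/
structure Code (𝒳 𝒴₁ 𝒴₂ : Type*) (n M₁ M₂ : ℕ) where
  /-- The encoder. -/
  enc : Fin M₁ → Fin M₂ → (Fin n → 𝒳)
  /-- The decoder of the first receiver. -/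
  dec₁ : (Fin n → 𝒴₁) → Fin M₁
  /-- The decoder of the second receiver. -/
  dec₂ : (Fin n → 𝒴₂) → Fin M₂

/-- Average probability of error of a code when it is used over the memoryless channel with
transition probabilities `p x (y₁, y₂)`, the two messages being independent and uniformly
distributed. An error occurs when at least one receiver decodes its own message wrongly. -/
def Code.errorProb [Fintype 𝒴₁] [Fintype 𝒴₂] (p : 𝒳 → PMF (𝒴₁ × 𝒴₂)) {n M₁ M₂ : ℕ}
    (c : Code 𝒳 𝒴₁ 𝒴₂ n M₁ M₂) : ℝ :=
  (∑ m₁ : Fin M₁, ∑ m₂ : Fin M₂, ∑ y : Fin n → 𝒴₁ × 𝒴₂,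
    if c.dec₁ (fun i => (y i).1) ≠ m₁ ∨ c.dec₂ (fun i => (y i).2) ≠ m₂ then
      ∏ i, (p (c.enc m₁ m₂ i) (y i)).toReal
    else 0) / ((M₁ : ℝ) * (M₂ : ℝ))

/-- The rate pair `(R₁, R₂)` (in nats per channel use) is achievable: there are codes of length
`n` with `⌈exp (n R₁)⌉` and `⌈exp (n R₂)⌉` messages whose average probability of error tends
to `0`. -/
def Achievable [Fintype 𝒴₁] [Fintype 𝒴₂] (p : 𝒳 → PMF (𝒴₁ × 𝒴₂)) (R₁ R₂ : ℝ) : Prop :=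
  0 ≤ R₁ ∧ 0 ≤ R₂ ∧
    ∃ c : ∀ n : ℕ, Code 𝒳 𝒴₁ 𝒴₂ n ⌈Real.exp (n * R₁)⌉₊ ⌈Real.exp (n * R₂)⌉₊,
      Tendsto (fun n => (c n).errorProb p) atTop (𝓝 0)

/-- The capacity region: the closure of the set of achievable rate pairs. -/
def capacityRegion [Fintype 𝒴₁] [Fintype 𝒴₂] (p : 𝒳 → PMF (𝒴₁ × 𝒴₂)) : Set (ℝ × ℝ) :=
  closure {R | Achievable p R.1 R.2}

end Channel

/-! ### Conditional mutual information -/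

/-- Conditional mutual information `I(A; B | C) ∈ [0, ∞]` (in nats), the relative entropy
`D(P_{C,A,B} ‖ P_C P_{A|C} P_{B|C})`. -/
def condMutualInfo {Ω α β γ : Type*} [MeasurableSpace Ω]
    [MeasurableSpace α] [StandardBorelSpace α] [Nonempty α]
    [MeasurableSpace β] [StandardBorelSpace β] [Nonempty β] [MeasurableSpace γ]
    (μ : Measure Ω) [IsFiniteMeasure μ] (A : Ω → α) (B : Ω → β) (C : Ω → γ) : ENNReal :=
  InformationTheory.klDiv (μ.map fun ω => (C ω, (A ω, B ω)))
    ((μ.map C).compProd ((condDistrib A C μ).prod (condDistrib B C μ)))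

/-! ### The outer bound -/

section OuterBound

variable {𝒳 𝒴₁ 𝒴₂ : Type*} [MeasurableSpace 𝒳]
  [MeasurableSpace 𝒴₁] [StandardBorelSpace 𝒴₁] [Nonempty 𝒴₁]
  [MeasurableSpace 𝒴₂] [StandardBorelSpace 𝒴₂] [Nonempty 𝒴₂]

/-- The conditions on the joint distribution of `(U, V, W₁, W₂, X, Y₁, Y₂)`. The auxiliary
variables are real valued, which covers all standard Borel alphabets, in particular all finite and
countable ones. -/
structure IsAdmissible (p : 𝒳 → PMF (𝒴₁ × 𝒴₂)) {Ω : Type*} [MeasurableSpace Ω]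
    (μ : Measure Ω) [IsProbabilityMeasure μ] (U V W₁ W₂ : Ω → ℝ)
    (X : Ω → 𝒳) (Y₁ : Ω → 𝒴₁) (Y₂ : Ω → 𝒴₂) : Prop where
  measurable_U : Measurable U
  measurable_V : Measurable V
  measurable_W₁ : Measurable W₁
  measurable_W₂ : Measurable W₂
  measurable_X : Measurable X
  measurable_Y₁ : Measurable Y₁
  measurable_Y₂ : Measurable Y₂
  /-- `(U, V, W₁, W₂) → X → (Y₁, Y₂)` is a Markov chain, and the conditional distribution of
  `(Y₁, Y₂)` given `X` is the channel `p`. -/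
  markov : ∀ B : Set (ℝ × ℝ × ℝ × ℝ), MeasurableSet B → ∀ (x : 𝒳) (y : 𝒴₁ × 𝒴₂),
    μ {ω | (U ω, V ω, W₁ ω, W₂ ω) ∈ B ∧ X ω = x ∧ (Y₁ ω, Y₂ ω) = y} =
      μ {ω | (U ω, V ω, W₁ ω, W₂ ω) ∈ B ∧ X ω = x} * p x y
  indep : IndepFun U V μ
  eq₁ : condMutualInfo μ U Y₁ W₁ = condMutualInfo μ U Y₁ (fun ω => (V ω, W₁ ω))
  eq₂ : condMutualInfo μ V Y₂ W₂ = condMutualInfo μ V Y₂ (fun ω => (U ω, W₂ ω))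
  eq₃ : condMutualInfo μ U V (fun ω => (W₁ ω, W₂ ω, Y₁ ω)) =
    condMutualInfo μ U V (fun ω => (W₁ ω, W₂ ω, Y₂ ω))
  eq₄ : condMutualInfo μ W₂ Y₁ W₁ = condMutualInfo μ W₁ Y₂ W₂
  eq₅ : condMutualInfo μ W₂ Y₁ (fun ω => (U ω, W₁ ω)) =
    condMutualInfo μ W₁ Y₂ (fun ω => (U ω, W₂ ω))
  eq₆ : condMutualInfo μ W₂ Y₁ (fun ω => (V ω, W₁ ω)) =
    condMutualInfo μ W₁ Y₂ (fun ω => (V ω, W₂ ω))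
  eq₇ : condMutualInfo μ W₂ Y₁ (fun ω => (U ω, V ω, W₁ ω)) =
    condMutualInfo μ W₁ Y₂ (fun ω => (U ω, V ω, W₂ ω))
  /-- The difference form of `eq₃`. By the chain rule,
  `I(U; V | W₁, W₂, Yᵢ) = I(U; V | W₁, W₂) + I(U; Yᵢ | V, W₁, W₂) - I(U; Yᵢ | W₁, W₂)`, so this
  is `eq₃` when `I(U; V | W₁, W₂)` is finite; it keeps the content of `eq₃` in the case where both
  sides of `eq₃` are infinite. All four terms here are finite when the output alphabets are. -/
  eq₃_diff :
    condMutualInfo μ U Y₁ (fun ω => (V ω, W₁ ω, W₂ ω)) +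
        condMutualInfo μ U Y₂ (fun ω => (W₁ ω, W₂ ω)) =
      condMutualInfo μ U Y₂ (fun ω => (V ω, W₁ ω, W₂ ω)) +
        condMutualInfo μ U Y₁ (fun ω => (W₁ ω, W₂ ω))

/-- The set of rate pairs `(R₁, R₂)` with `R₁ ≤ I(U; Y₁ | W₁)` and `R₂ ≤ I(V; Y₂ | W₂)` for some
admissible `(U, V, W₁, W₂, X, Y₁, Y₂)`. -/
def outerRegion (p : 𝒳 → PMF (𝒴₁ × 𝒴₂)) : Set (ℝ × ℝ) :=
  {R | ∃ (Ω : Type) (_ : MeasurableSpace Ω) (μ : Measure Ω) (_ : IsProbabilityMeasure μ)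
    (U V W₁ W₂ : Ω → ℝ) (X : Ω → 𝒳) (Y₁ : Ω → 𝒴₁) (Y₂ : Ω → 𝒴₂),
    IsAdmissible p μ U V W₁ W₂ X Y₁ Y₂ ∧
      ENNReal.ofReal R.1 ≤ condMutualInfo μ U Y₁ W₁ ∧
      ENNReal.ofReal R.2 ≤ condMutualInfo μ V Y₂ W₂}

end OuterBound

end BroadcastChannel

end

/-!
Given codes with vanishing error probability, let `U` and `V` be the two messages and, at a
uniformly distributed time, let `W₁` be the past outputs of the first receiver and `W₂` the future
outputs of the second one. Csiszár's sum identity, applied given each of the four subsets of the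
messages, yields `eq₄` to `eq₇`. Fano's inequality yields `eq₁`, `eq₂` and the two rate bounds up to
an error that vanishes with the length of the code. The identity `eq₃` follows from the others by
the chain rule.

To pass to the limit with auxiliary variables of unbounded size, note that all these conditions
depend only on the joint distribution of the posteriors of the input given the subsets of
`{U, V, W₁, W₂}`. The posteriors lie in a compact space, so the approximate conditions have an exact
solution in the limit. To turn the limit back into random variables, share each posterior `κ S`
secretly among the parties in `S`: encode it in the circle and split it into uniform summands,
completed by `W₁` or `W₂`. The parties in `A` jointly learn exactly the posteriors of the subsets of
`A`, and `U` and `V` hold independent noise only.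
-/

noncomputable section

namespace BroadcastChannel

open InformationTheory
open scoped ENNReal

/-! ### The chain rule for conditional mutual information -/

section ChainRule

variable {α β γ δ ε Ω : Type*} [MeasurableSpace α] [MeasurableSpace β] [MeasurableSpace γ]
  [MeasurableSpace δ] [MeasurableSpace ε] [MeasurableSpace Ω]

lemma klDiv_map_measurableEquiv (e : α ≃ᵐ β) (μ ν : Measure α) [IsFiniteMeasure μ]
    [IsFiniteMeasure ν] : klDiv (μ.map e) (ν.map e) = klDiv μ ν := by
  refine le_antisymm (klDiv_map_le μ ν e.measurable) ?_
  have h := klDiv_map_le (μ.map e) (ν.map e) e.symm.measurable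
  simpa [Measure.map_map e.symm.measurable e.measurable] using h

/-- The measurable equivalence swapping the last two of three factors. -/
def prodRightComm (γ β α : Type*) [MeasurableSpace γ] [MeasurableSpace β] [MeasurableSpace α] :
    (γ × β) × α ≃ᵐ (γ × α) × β where
  toFun x := ((x.1.1, x.2), x.1.2)
  invFun x := ((x.1.1, x.2), x.1.2)
  left_inv _ := rfl
  right_inv _ := rfl
  measurable_toFun := by simp only [Equiv.coe_fn_mk]; fun_prop
  measurable_invFun := by simp only [Equiv.coe_fn_symm_mk]; fun_prop

lemma map_prodAssoc_symm_compProd_prod (ν : Measure γ) [SFinite ν] (κ : Kernel γ α)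
    [IsSFiniteKernel κ] (η : Kernel γ β) [IsSFiniteKernel η] :
    (ν ⊗ₘ κ.prod η).map MeasurableEquiv.prodAssoc.symm = (ν ⊗ₘ κ) ⊗ₘ η.prodMkRight α := by
  refine Measure.ext_of_lintegral _ fun f hf => ?_
  rw [lintegral_map hf (by fun_prop), Measure.lintegral_compProd (by fun_prop),
    Measure.lintegral_compProd hf, Measure.lintegral_compProd hf.lintegral_kernel_prod_right']
  refine lintegral_congr fun c => ?_
  rw [Kernel.prod_apply, lintegral_prod _ (by fun_prop)]
  rfl

lemma map_prodRightComm_compProd_prodMkRight (ν : Measure γ) [SFinite ν] (κ : Kernel γ α)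
    [IsSFiniteKernel κ] (η : Kernel γ β) [IsSFiniteKernel η] :
    ((ν ⊗ₘ η) ⊗ₘ κ.prodMkRight β).map (prodRightComm γ β α) =
      (ν ⊗ₘ κ) ⊗ₘ η.prodMkRight α := by
  refine Measure.ext_of_lintegral _ fun f hf => ?_
  have hfe : Measurable fun x => f (prodRightComm γ β α x) := by fun_prop
  rw [lintegral_map_equiv, Measure.lintegral_compProd hfe,
    Measure.lintegral_compProd hfe.lintegral_kernel_prod_right', Measure.lintegral_compProd hf,
    Measure.lintegral_compProd hf.lintegral_kernel_prod_right']
  refine lintegral_congr fun c => ?_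
  have hc : Measurable fun p : β × α => f (prodRightComm γ β α ((c, p.1), p.2)) := by fun_prop
  simp only [Kernel.prodMkRight_apply]
  rw [lintegral_lintegral_swap (f := fun b a => f (prodRightComm γ β α ((c, b), a)))
    hc.aemeasurable]
  rfl

variable [StandardBorelSpace α] [Nonempty α] [StandardBorelSpace β] [Nonempty β]
  [StandardBorelSpace ε] [Nonempty ε] {μ : Measure Ω} [IsFiniteMeasure μ]
  {A : Ω → α} {B : Ω → β} {C : Ω → γ} {Y : Ω → ε}

lemma condMutualInfo_eq_klDiv_right (hA : Measurable A) (hB : Measurable B) (hC : Measurable C) :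
    condMutualInfo μ A B C = klDiv (μ.map fun ω => ((C ω, A ω), B ω))
      ((μ.map fun ω => (C ω, A ω)) ⊗ₘ (condDistrib B C μ).prodMkRight α) := by
  rw [condMutualInfo, ← klDiv_map_measurableEquiv MeasurableEquiv.prodAssoc.symm,
    map_prodAssoc_symm_compProd_prod, compProd_map_condDistrib hA.aemeasurable,
    Measure.map_map (by fun_prop) (by fun_prop)]
  rfl

lemma klDiv_compProd_prodMkRight (hA : Measurable A) (hB : Measurable B) (hC : Measurable C)
    (κ : Kernel γ α) [IsMarkovKernel κ] :
    klDiv (μ.map fun ω => ((C ω, B ω), A ω)) ((μ.map fun ω => (C ω, B ω)) ⊗ₘ κ.prodMkRight β) =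
      klDiv (μ.map fun ω => (C ω, A ω)) (μ.map C ⊗ₘ κ) + condMutualInfo μ A B C := by
  have hmap : (μ.map fun ω => ((C ω, B ω), A ω)).map (prodRightComm γ β α) =
      (μ.map fun ω => (C ω, A ω)) ⊗ₘ condDistrib B (fun ω => (C ω, A ω)) μ := by
    rw [compProd_map_condDistrib hB.aemeasurable, Measure.map_map (by fun_prop) (by fun_prop)]
    rfl
  rw [← klDiv_map_measurableEquiv (prodRightComm γ β α), hmap,
    ← compProd_map_condDistrib (X := C) hB.aemeasurable, map_prodRightComm_compProd_prodMkRight,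
    klDiv_compProd_eq_add, compProd_map_condDistrib hB.aemeasurable,
    condMutualInfo_eq_klDiv_right hA hB hC]

lemma condMutualInfo_eq_klDiv_left (hA : Measurable A) (hB : Measurable B) (hC : Measurable C) :
    condMutualInfo μ A B C = klDiv (μ.map fun ω => ((C ω, B ω), A ω))
      ((μ.map fun ω => (C ω, B ω)) ⊗ₘ (condDistrib A C μ).prodMkRight β) := by
  rw [klDiv_compProd_prodMkRight hA hB hC, compProd_map_condDistrib hA.aemeasurable, klDiv_self,
    zero_add]

lemma condDistrib_comp_measurableEquiv_ae (hA : Measurable A) (hC : Measurable C) (e : γ ≃ᵐ δ) :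
    ∀ᵐ c ∂(μ.map C), condDistrib A (fun ω => e (C ω)) μ (e c) = condDistrib A C μ c := by
  suffices h : μ.map (fun ω => (C ω, A ω)) =
      μ.map C ⊗ₘ (condDistrib A (fun ω => e (C ω)) μ).comap e e.measurable by
    filter_upwards [condDistrib_ae_eq_of_measure_eq_compProd C hA.aemeasurable h] with c hc
    rw [hc, Kernel.comap_apply]
  have hmap : μ.map (fun ω => (C ω, A ω)) =
      (μ.map (fun ω => (e (C ω), A ω))).map (Prod.map e.symm id) := by
    rw [Measure.map_map (by fun_prop) (by fun_prop)]
    congr 1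
    ext ω <;> simp
  have hmapC : (μ.map fun ω => e (C ω)) = (μ.map C).map e := by
    rw [Measure.map_map e.measurable hC]; rfl
  rw [hmap, ← compProd_map_condDistrib hA.aemeasurable]
  refine Measure.ext_of_lintegral _ fun f hf => ?_
  rw [lintegral_map hf (by fun_prop), Measure.lintegral_compProd (by fun_prop),
    Measure.lintegral_compProd hf, hmapC, lintegral_map_equiv]
  simp

lemma condMutualInfo_comp_measurableEquiv (hA : Measurable A) (hB : Measurable B)
    (hC : Measurable C) (e : γ ≃ᵐ δ) :
    condMutualInfo μ A B (fun ω => e (C ω)) = condMutualInfo μ A B C := by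
  have hmapC : (μ.map fun ω => e (C ω)) = (μ.map C).map e := by
    rw [Measure.map_map e.measurable hC]; rfl
  rw [condMutualInfo, condMutualInfo,
    ← klDiv_map_measurableEquiv (e.prodCongr (MeasurableEquiv.refl (α × β)))
      (μ.map fun ω => (C ω, A ω, B ω)), Measure.map_map (by fun_prop) (by fun_prop)]
  congr 1
  refine Measure.ext_of_lintegral _ fun f hf => ?_
  rw [lintegral_map hf (by fun_prop), Measure.lintegral_compProd hf,
    Measure.lintegral_compProd (by fun_prop), hmapC, lintegral_map_equiv]
  refine lintegral_congr_ae ?_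
  filter_upwards [condDistrib_comp_measurableEquiv_ae hA hC e,
    condDistrib_comp_measurableEquiv_ae hB hC e] with c hAc hBc
  rw [Kernel.prod_apply, Kernel.prod_apply, hAc, hBc]
  rfl

/-- Both sides are expansions of `I(A; (B, Y) | C)`. -/
lemma condMutualInfo_add_condMutualInfo_comm (hA : Measurable A) (hB : Measurable B)
    (hC : Measurable C) (hY : Measurable Y) :
    condMutualInfo μ A Y C + condMutualInfo μ A B (fun ω => (C ω, Y ω)) =
      condMutualInfo μ A B C + condMutualInfo μ A Y (fun ω => (C ω, B ω)) := by
  rw [condMutualInfo_eq_klDiv_left (C := C) hA hY hC,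
    condMutualInfo_eq_klDiv_left (C := C) hA hB hC,
    ← klDiv_compProd_prodMkRight (C := fun ω => (C ω, Y ω)) hA hB (by fun_prop),
    ← klDiv_compProd_prodMkRight (C := fun ω => (C ω, B ω)) hA hY (by fun_prop),
    ← klDiv_map_measurableEquiv ((prodRightComm γ ε β).prodCongr (MeasurableEquiv.refl α))]
  congr 1
  · rw [Measure.map_map (by fun_prop) (by fun_prop)]
    rfl
  · refine Measure.ext_of_lintegral _ fun f hf => ?_
    have hfe : Measurable fun x =>
        f ((prodRightComm γ ε β).prodCongr (MeasurableEquiv.refl α) x) := by fun_prop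
    rw [lintegral_map_equiv, Measure.lintegral_compProd hfe,
      Measure.lintegral_compProd hf, lintegral_map hfe.lintegral_kernel_prod_right' (by fun_prop),
      lintegral_map hf.lintegral_kernel_prod_right' (by fun_prop)]
    rfl

lemma condMutualInfo_prodMk_congr_of_diff {ζ : Type*} [MeasurableSpace ζ] [StandardBorelSpace ζ]
    [Nonempty ζ] {Z : Ω → ζ} (hA : Measurable A) (hB : Measurable B) (hC : Measurable C)
    (hY : Measurable Y) (hZ : Measurable Z) (hAY : condMutualInfo μ A Y C ≠ ∞)
    (hAZ : condMutualInfo μ A Z C ≠ ∞)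
    (hdiff : condMutualInfo μ A Y (fun ω => (C ω, B ω)) + condMutualInfo μ A Z C =
      condMutualInfo μ A Z (fun ω => (C ω, B ω)) + condMutualInfo μ A Y C) :
    condMutualInfo μ A B (fun ω => (C ω, Y ω)) = condMutualInfo μ A B (fun ω => (C ω, Z ω)) := by
  refine (ENNReal.add_right_inj (ENNReal.add_ne_top.2 ⟨hAY, hAZ⟩)).1 ?_
  calc condMutualInfo μ A Y C + condMutualInfo μ A Z C +
        condMutualInfo μ A B (fun ω => (C ω, Y ω))
      = condMutualInfo μ A B C + (condMutualInfo μ A Y (fun ω => (C ω, B ω)) +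
          condMutualInfo μ A Z C) := by
        rw [add_right_comm, condMutualInfo_add_condMutualInfo_comm hA hB hC hY, add_assoc]
    _ = condMutualInfo μ A Y C + condMutualInfo μ A Z C +
        condMutualInfo μ A B (fun ω => (C ω, Z ω)) := by
        rw [hdiff, ← add_assoc, ← condMutualInfo_add_condMutualInfo_comm hA hB hC hZ]
        abel

end ChainRule

/-! ### Entropy of finite-valued random variables -/

lemma sum_klFun_div_add_sum_negMulLog {β : Type*} [Fintype β] {k e : β → ℝ} (hk : ∀ b, 0 ≤ k b)
    (he : ∀ b, 0 ≤ e b) (hke : ∀ b, e b = 0 → k b = 0) :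
    ∑ b, klFun (k b / e b) * e b + ∑ b, Real.negMulLog (k b) =
      ∑ b, k b * -Real.log (e b) + (∑ b, e b - ∑ b, k b) := by
  rw [← Finset.sum_add_distrib, ← Finset.sum_sub_distrib, ← Finset.sum_add_distrib]
  refine Finset.sum_congr rfl fun b _ => ?_
  rcases (he b).eq_or_lt with he0 | he0
  · simp [← he0, hke b he0.symm]
  rcases (hk b).eq_or_lt with hk0 | hk0
  · simp [← hk0, klFun_zero]
  rw [klFun_apply, Real.negMulLog, Real.log_div hk0.ne' he0.ne']
  field_simp
  ring

section Entropy

variable {τ β : Type*} [MeasurableSpace τ] [MeasurableSpace β] [MeasurableSingletonClass β]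

lemma compProd_eq_withDensity_div [Countable β] {ρ : Measure τ} [SFinite ρ] {κ η : Kernel τ β}
    [IsSFiniteKernel κ] [IsFiniteKernel η] (hκη : ∀ᵐ t ∂ρ, ∀ b, η t {b} = 0 → κ t {b} = 0) :
    ρ ⊗ₘ κ = (ρ ⊗ₘ η).withDensity fun x => κ x.1 {x.2} / η x.1 {x.2} := by
  have hdensity : Measurable fun x : τ × β => κ x.1 {x.2} / η x.1 {x.2} :=
    measurable_from_prod_countable_left fun b =>
      (Kernel.measurable_coe κ (measurableSet_singleton b)).div
        (Kernel.measurable_coe η (measurableSet_singleton b))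
  refine Measure.ext_of_lintegral _ fun f hf => ?_
  rw [lintegral_withDensity_eq_lintegral_mul _ hdensity hf, Measure.lintegral_compProd hf,
    Measure.lintegral_compProd (hdensity.mul hf)]
  refine lintegral_congr_ae ?_
  filter_upwards [hκη] with t ht
  rw [lintegral_countable', lintegral_countable']
  refine tsum_congr fun b => ?_
  by_cases hb : η t {b} = 0
  · simp [hb, ht b hb]
  · rw [Pi.mul_apply, mul_right_comm, ENNReal.div_mul_cancel hb (measure_ne_top _ _), mul_comm]

variable [Fintype β]

lemma lintegral_klFun_div_add_sum_negMulLog {ξ ζ : Measure β} [IsProbabilityMeasure ξ]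
    [IsProbabilityMeasure ζ] (hξζ : ∀ b, ζ {b} = 0 → ξ {b} = 0) :
    ∫⁻ b, ENNReal.ofReal (klFun (ξ {b} / ζ {b}).toReal) ∂ζ +
        ∑ b, ENNReal.ofReal (Real.negMulLog (ξ.real {b})) =
      ∑ b, ξ {b} * ENNReal.ofReal (-Real.log (ζ.real {b})) := by
  have hkl : ∀ b, 0 ≤ klFun (ξ.real {b} / ζ.real {b}) * ζ.real {b} := fun b =>
    mul_nonneg (klFun_nonneg (by positivity)) measureReal_nonneg
  have hnegMulLog : ∀ b, 0 ≤ Real.negMulLog (ξ.real {b}) := fun b =>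
    Real.negMulLog_nonneg measureReal_nonneg measureReal_le_one
  have hlog : ∀ b, 0 ≤ ξ.real {b} * -Real.log (ζ.real {b}) := fun b =>
    mul_nonneg measureReal_nonneg
      (neg_nonneg.2 (Real.log_nonpos measureReal_nonneg measureReal_le_one))
  have hξ : ∑ b, ξ.real {b} = 1 := by simp
  have hζ : ∑ b, ζ.real {b} = 1 := by simp
  have hgibbs := sum_klFun_div_add_sum_negMulLog (k := fun b => ξ.real {b})
    (e := fun b => ζ.real {b}) (fun b => measureReal_nonneg) (fun b => measureReal_nonneg)
    (fun b hb => by rw [measureReal_eq_zero_iff] at hb ⊢; exact hξζ b hb)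
  rw [hξ, hζ, sub_self, add_zero] at hgibbs
  calc ∫⁻ b, ENNReal.ofReal (klFun (ξ {b} / ζ {b}).toReal) ∂ζ
        + ∑ b, ENNReal.ofReal (Real.negMulLog (ξ.real {b}))
      = ENNReal.ofReal (∑ b, klFun (ξ.real {b} / ζ.real {b}) * ζ.real {b}
          + ∑ b, Real.negMulLog (ξ.real {b})) := by
        rw [lintegral_fintype, ENNReal.ofReal_add (Finset.sum_nonneg fun b _ => hkl b)
          (Finset.sum_nonneg fun b _ => hnegMulLog b),
          ENNReal.ofReal_sum_of_nonneg fun b _ => hkl b,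
          ENNReal.ofReal_sum_of_nonneg fun b _ => hnegMulLog b]
        congr 1
        refine Finset.sum_congr rfl fun b _ => ?_
        rw [ENNReal.ofReal_mul (klFun_nonneg (by positivity)), ofReal_measureReal,
          ENNReal.toReal_div]
        rfl
    _ = ∑ b, ξ {b} * ENNReal.ofReal (-Real.log (ζ.real {b})) := by
        rw [hgibbs, ENNReal.ofReal_sum_of_nonneg fun b _ => hlog b]
        refine Finset.sum_congr rfl fun b _ => ?_
        rw [ENNReal.ofReal_mul measureReal_nonneg, ofReal_measureReal]

lemma klDiv_compProd_add_lintegral_negMulLog {ρ : Measure τ} [IsFiniteMeasure ρ]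
    {κ η : Kernel τ β} [IsMarkovKernel κ] [IsMarkovKernel η]
    (hκη : ∀ᵐ t ∂ρ, ∀ b, η t {b} = 0 → κ t {b} = 0) :
    klDiv (ρ ⊗ₘ κ) (ρ ⊗ₘ η) + ∫⁻ t, ∑ b, ENNReal.ofReal (Real.negMulLog ((κ t).real {b})) ∂ρ =
      ∫⁻ t, ∑ b, κ t {b} * ENNReal.ofReal (-Real.log ((η t).real {b})) ∂ρ := by
  let density : τ × β → ℝ≥0∞ := fun x => κ x.1 {x.2} / η x.1 {x.2}
  have hdensity : Measurable density := measurable_from_prod_countable_left fun b =>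
    (Kernel.measurable_coe κ (measurableSet_singleton b)).div
      (Kernel.measurable_coe η (measurableSet_singleton b))
  have hcompProd : ρ ⊗ₘ κ = (ρ ⊗ₘ η).withDensity density := compProd_eq_withDensity_div hκη
  have hrnDeriv : (ρ ⊗ₘ κ).rnDeriv (ρ ⊗ₘ η) =ᵐ[ρ ⊗ₘ η] density := by
    rw [hcompProd]; exact Measure.rnDeriv_withDensity _ hdensity
  have hklFun : Measurable fun x => ENNReal.ofReal (klFun (density x).toReal) :=
    (measurable_klFun.comp hdensity.ennreal_toReal).ennreal_ofReal
  have hac : ρ ⊗ₘ κ ≪ ρ ⊗ₘ η := by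
    rw [hcompProd]; exact withDensity_absolutelyContinuous _ _
  rw [klDiv_eq_lintegral_klFun_of_ac hac,
    lintegral_congr_ae (g := fun x => ENNReal.ofReal (klFun (density x).toReal))
      (by filter_upwards [hrnDeriv] with x hx using by rw [hx]),
    Measure.lintegral_compProd hklFun, ← lintegral_add_left hklFun.lintegral_kernel_prod_right']
  refine lintegral_congr_ae ?_
  filter_upwards [hκη] with t ht
  simpa only [density] using lintegral_klFun_div_add_sum_negMulLog ht

end Entropy

section CondEntropy

variable {Ω α β γ : Type*} [MeasurableSpace Ω] [MeasurableSpace α] [MeasurableSpace β]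
  [StandardBorelSpace β] [Nonempty β] [MeasurableSpace γ] {μ : Measure Ω} [IsFiniteMeasure μ]
  {A : Ω → α} {B : Ω → β} {C : Ω → γ}

lemma lintegral_condDistrib_prodMk (hA : Measurable A) (hB : Measurable B) (hC : Measurable C)
    {f : γ × β → ℝ≥0∞} (hf : Measurable f) :
    ∫⁻ x, ∫⁻ b, f (x.1, b) ∂(condDistrib B (fun ω => (C ω, A ω)) μ x)
        ∂(μ.map fun ω => (C ω, A ω)) =
      ∫⁻ c, ∫⁻ b, f (c, b) ∂(condDistrib B C μ c) ∂(μ.map C) := by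
  have hfst := Measure.lintegral_compProd (μ := μ.map fun ω => (C ω, A ω))
    (κ := condDistrib B (fun ω => (C ω, A ω)) μ) (f := fun x => f (x.1.1, x.2)) (by fun_prop)
  rw [← hfst, ← Measure.lintegral_compProd hf, compProd_map_condDistrib hB.aemeasurable,
    compProd_map_condDistrib hB.aemeasurable, lintegral_map hf (by fun_prop),
    lintegral_map (by fun_prop) (by fun_prop)]

lemma ae_condDistrib_prodMk_eq_zero [Countable β] [MeasurableSingletonClass β]
    (hA : Measurable A) (hB : Measurable B) (hC : Measurable C) :
    ∀ᵐ x ∂(μ.map fun ω => (C ω, A ω)), ∀ b, condDistrib B C μ x.1 {b} = 0 →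
      condDistrib B (fun ω => (C ω, A ω)) μ x {b} = 0 := by
  let null : γ → Set β := fun c => {b | condDistrib B C μ c {b} = 0}
  let f : γ × β → ℝ≥0∞ := fun x => (null x.1).indicator 1 x.2
  have hf : Measurable f := measurable_from_prod_countable_left fun b =>
    measurable_one.indicator (measurableSet_eq_fun
      (Kernel.measurable_coe _ (measurableSet_singleton b)) measurable_const)
  have hlintegral : ∀ c (ν : Measure β), ∫⁻ b, f (c, b) ∂ν = ν (null c) := fun c ν =>
    lintegral_indicator_one (Set.to_countable _).measurableSet
  have hnull : ∀ c, condDistrib B C μ c (null c) = 0 := fun c =>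
    (measure_null_iff_singleton (Set.to_countable _)).2 fun b hb => hb
  have h := lintegral_condDistrib_prodMk (μ := μ) hA hB hC hf
  have hfst : Measurable fun x : (γ × α) × β => f (x.1.1, x.2) := by fun_prop
  simp only [hlintegral _ (condDistrib B C μ _), hnull, lintegral_zero] at h
  rw [lintegral_eq_zero_iff hfst.lintegral_kernel_prod_right'] at h
  filter_upwards [h] with x hx b hb
  exact measure_mono_null (Set.singleton_subset_iff.2 hb) ((hlintegral _ _).symm.trans hx)

end CondEntropy

section CondEntropy

variable {Ω α β γ : Type*} [MeasurableSpace Ω] [MeasurableSpace α] [StandardBorelSpace α]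
  [Nonempty α] [Fintype β] [Nonempty β] [MeasurableSpace β] [MeasurableSingletonClass β]
  [MeasurableSpace γ] {μ : Measure Ω} [IsFiniteMeasure μ] {A : Ω → α} {B : Ω → β} {C : Ω → γ}

/-- Conditional entropy `H(B | C)` (in nats) of a finite-valued random variable. -/
def condEntropy (μ : Measure Ω) [IsFiniteMeasure μ] (B : Ω → β) (C : Ω → γ) : ℝ≥0∞ :=
  ∫⁻ c, ∑ b, ENNReal.ofReal (Real.negMulLog ((condDistrib B C μ c).real {b})) ∂(μ.map C)

lemma condMutualInfo_add_condEntropy (hA : Measurable A) (hB : Measurable B) (hC : Measurable C) :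
    condMutualInfo μ A B C + condEntropy μ B (fun ω => (C ω, A ω)) = condEntropy μ B C := by
  have hlog : Measurable fun x : γ × β =>
      ENNReal.ofReal (-Real.log ((condDistrib B C μ x.1).real {x.2})) :=
    measurable_from_prod_countable_left fun b => (Real.measurable_log.comp
      (Kernel.measurable_coe _ (measurableSet_singleton b)).ennreal_toReal).neg.ennreal_ofReal
  have haverage := lintegral_condDistrib_prodMk (μ := μ) hA hB hC hlog
  simp only [lintegral_fintype, mul_comm (ENNReal.ofReal _)] at haverage
  rw [condMutualInfo_eq_klDiv_right hA hB hC,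
    ← compProd_map_condDistrib (X := fun ω => (C ω, A ω)) hB.aemeasurable, condEntropy,
    klDiv_compProd_add_lintegral_negMulLog (ae_condDistrib_prodMk_eq_zero hA hB hC)]
  refine haverage.trans (lintegral_congr fun c => Finset.sum_congr rfl fun b _ => ?_)
  rw [Real.negMulLog, neg_mul_comm, ENNReal.ofReal_mul measureReal_nonneg, ofReal_measureReal]

lemma condEntropy_eq_lintegral (hB : Measurable B) (hC : Measurable C) {q : γ → β → ℝ≥0∞}
    (hq : ∀ b, Measurable fun c => q c b)
    (h : ∀ s, MeasurableSet s → ∀ b, μ (C ⁻¹' s ∩ B ⁻¹' {b}) = ∫⁻ ω in C ⁻¹' s, q (C ω) b ∂μ) :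
    condEntropy μ B C =
      ∫⁻ ω, ∑ b, ENNReal.ofReal (Real.negMulLog (q (C ω) b).toReal) ∂μ := by
  have hae : ∀ᵐ c ∂(μ.map C), ∀ b, condDistrib B C μ c {b} = q c b := by
    refine ae_all_iff.2 fun b => ae_eq_of_forall_setLIntegral_eq_of_sigmaFinite
      (Kernel.measurable_coe _ (measurableSet_singleton b)) (hq b) fun s hs _ => ?_
    rw [← Measure.compProd_apply_prod hs (measurableSet_singleton b),
      compProd_map_condDistrib hB.aemeasurable, Measure.map_apply (by fun_prop)
        (hs.prod (measurableSet_singleton b)), setLIntegral_map hs (hq b) hC, ← h s hs b]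
    rfl
  have hentropy : condEntropy μ B C =
      ∫⁻ c, ∑ b, ENNReal.ofReal (Real.negMulLog (q c b).toReal) ∂(μ.map C) :=
    lintegral_congr_ae <| by filter_upwards [hae] with c hc; simp only [Measure.real, hc]
  rw [hentropy, lintegral_map (by fun_prop) hC]

end CondEntropy

/-! ### Secret sharing -/

lemma indepFun_comp_measurePreserving {Ω Ω' α β : Type*} [MeasurableSpace Ω] [MeasurableSpace Ω']
    [MeasurableSpace α] [MeasurableSpace β] {μ : Measure Ω} {ρ : Measure Ω'} {φ : Ω → Ω'}
    {f : Ω' → α} {g : Ω' → β} (hφ : MeasurePreserving φ μ ρ) (hf : Measurable f)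
    (hg : Measurable g) (h : IndepFun f g ρ) : IndepFun (f ∘ φ) (g ∘ φ) μ := by
  rw [indepFun_iff_measure_inter_preimage_eq_mul] at h ⊢
  intro s t hs ht
  have := h s t hs ht
  rwa [← hφ.measure_preimage (hf hs).nullMeasurableSet,
    ← hφ.measure_preimage (hg ht).nullMeasurableSet,
    ← hφ.measure_preimage ((hf hs).inter (hg ht)).nullMeasurableSet] at this

section SecretSharing

variable {ι E G : Type*} [DecidableEq ι]

/-- Erase the secrets of the sets that are not contained in `A`. -/
def forget [Nonempty E] (A : Finset ι) (s : Finset ι → E) : Finset ι → E :=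
  fun S => if S ⊆ A then s S else Classical.arbitrary E

lemma measurable_forget [Nonempty E] [MeasurableSpace E] (A : Finset ι) :
    Measurable (forget (E := E) A) := by
  refine measurable_pi_lambda _ fun S => ?_
  unfold forget
  split_ifs <;> fun_prop

lemma continuous_forget [Nonempty E] [TopologicalSpace E] (A : Finset ι) :
    Continuous (forget (E := E) A) := by
  refine continuous_pi fun S => ?_
  unfold forget
  split_ifs <;> fun_prop

variable [AddCommGroup G] (leader : Finset ι → ι) (e : E → G)

/-- The shares held by the parties in `A` when the secret `z.1 S` of each set `S` of parties is
split among its members. The share of party `i` is the noise `z.2 i S`, except that the leader of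
`S` completes the sum of the shares to the code `e (z.1 S)` of the secret. Shares that do not exist
or are not held by `A` are set to `0`. -/
def shares (A : Finset ι) (z : (Finset ι → E) × (ι → Finset ι → G)) : ι → Finset ι → G :=
  fun i S =>
    if i ∈ A ∧ i ∈ S then
      if i = leader S then e (z.1 S) - ∑ j ∈ S.erase i, z.2 j S else z.2 i S
    else 0

variable {leader}

lemma sum_shares {A : Finset ι} (hA : leader A ∈ A) (z : (Finset ι → E) × (ι → Finset ι → G)) :
    ∑ i ∈ A, shares leader e A z i A = e (z.1 A) := by
  have hnoise : ∀ i ∈ A.erase (leader A), shares leader e A z i A = z.2 i A := fun i hi => by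
    simp [shares, (Finset.mem_erase.1 hi).1, (Finset.mem_erase.1 hi).2]
  rw [← Finset.add_sum_erase _ _ hA, Finset.sum_congr rfl hnoise]
  simp [shares, hA]

lemma shares_apply_of_ne_leader {i : ι} (hi : ∀ S, i ≠ leader S)
    (z : (Finset ι → E) × (ι → Finset ι → G)) (A : Finset ι) (S : Finset ι) :
    shares leader e A z i S = if i ∈ A ∧ i ∈ S then z.2 i S else 0 := by
  simp [shares, hi S]

lemma shares_eq_piecewise {A B : Finset ι} (hAB : A ⊆ B)
    (z : (Finset ι → E) × (ι → Finset ι → G)) :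
    shares leader e A z = A.piecewise (shares leader e B z) 0 := by
  funext i S
  by_cases hi : i ∈ A
  · simp [shares, hi, hAB hi]
  · simp [shares, hi]

/-- Shifting the noise of a party outside `A` in each set `S` that is not contained in `A` hides the
secret of `S` from `A`. -/
lemma exists_shares_add_eq_shares_forget [Nonempty E] (leader : Finset ι → ι) (A : Finset ι)
    (s : Finset ι → E) :
    ∃ t : ι → Finset ι → G, ∀ k,
      shares leader e A (s, t + k) = shares leader e A (forget A s, k) := by
  have : Nonempty ι := ⟨leader ∅⟩
  choose! outsider houtsider using fun S (hS : ¬ S ⊆ A) => Finset.not_subset.1 hS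
  refine ⟨fun j S => if ¬ S ⊆ A ∧ j = outsider S then e (s S) - e (Classical.arbitrary E) else 0,
    fun k => ?_⟩
  funext i S
  by_cases hi : i ∈ A ∧ i ∈ S
  swap
  · simp [shares, hi]
  by_cases hS : S ⊆ A
  · simp [shares, forget, hS]
  have hne : outsider S ≠ i := fun h => (houtsider S hS).2 (h ▸ hi.1)
  have hmem : outsider S ∈ S.erase i := Finset.mem_erase.2 ⟨hne, (houtsider S hS).1⟩
  by_cases hleader : i = leader S
  · simp only [shares, hleader, forget, hS, Pi.add_apply, Finset.sum_add_distrib]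
    rw [← hleader]
    simp only [hi, hmem, Finset.sum_ite_eq', not_false_eq_true, true_and, and_self, if_true,
      if_false]
    abel
  · simp [shares, hi, hleader, hne.symm]

variable [MeasurableSpace E] [MeasurableSpace G] [MeasurableAdd₂ G] [MeasurableSub₂ G]

variable {e} in
lemma measurable_shares (he : Measurable e) (A : Finset ι) :
    Measurable (shares leader e A) := by
  refine measurable_pi_lambda _ fun i => measurable_pi_lambda _ fun S => ?_
  unfold shares
  split_ifs
  · have : Measurable fun z : (Finset ι → E) × (ι → Finset ι → G) => e (z.1 S) := by
      fun_prop
    fun_prop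
  · fun_prop
  · fun_prop

end SecretSharing

section Secrecy

variable {ι E G : Type*} [Fintype ι] [DecidableEq ι] [MeasurableSpace E] [MeasurableSpace G]

/-- Independent noise with distribution `ν`, one variable for each party and each set. -/
abbrev noise (ι : Type*) [Fintype ι] (ν : Measure G) [SigmaFinite ν] :
    Measure (ι → Finset ι → G) :=
  Measure.pi fun _ => Measure.pi fun _ => ν

variable [AddCommGroup G] {ν : Measure G} [IsProbabilityMeasure ν] {leader : Finset ι → ι}
  {e : E → G}

lemma indepFun_shares {i j : ι} (hij : i ≠ j) (hi : ∀ S, i ≠ leader S) (hj : ∀ S, j ≠ leader S)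
    (P : Measure (Finset ι → E)) [IsProbabilityMeasure P] :
    IndepFun (fun z => shares leader e Finset.univ z i) (fun z => shares leader e Finset.univ z j)
      (P.prod (noise ι ν)) := by
  let mask : ι → (Finset ι → G) → Finset ι → G := fun i k S => if i ∈ S then k S else 0
  have hmask : ∀ i, Measurable (mask i) := fun i => measurable_pi_lambda _ fun S => by
    simp only [mask]
    split_ifs <;> fun_prop
  have hshares : ∀ i, (∀ S, i ≠ leader S) →
      (fun z : (Finset ι → E) × (ι → Finset ι → G) => shares leader e Finset.univ z i) =
        (fun k : ι → Finset ι → G => mask i (k i)) ∘ Prod.snd := fun i hi => by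
    ext z S
    simp [shares_apply_of_ne_leader e hi, mask]
  have hindep : IndepFun (fun k : ι → Finset ι → G => mask i (k i)) (fun k => mask j (k j))
      (noise ι ν) := (iIndepFun_pi fun i => (hmask i).aemeasurable).indepFun hij
  rw [hshares i hi, hshares j hj]
  exact indepFun_comp_measurePreserving measurePreserving_snd
    ((hmask i).comp (measurable_pi_apply i)) ((hmask j).comp (measurable_pi_apply j)) hindep

variable [MeasurableAdd₂ G] [MeasurableSub₂ G]

/-- The shares of `A` carry no information on the secrets of the sets not contained in `A`. -/
lemma map_shares_prod_noise [Nonempty E] [ν.IsAddLeftInvariant] (he : Measurable e)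
    (P : Measure (Finset ι → E)) [SFinite P] (A : Finset ι) :
    (P.prod (noise ι ν)).map (shares leader e A) =
      ((P.map (forget A)).prod (noise ι ν)).map (shares leader e A) := by
  refine Measure.ext_of_lintegral _ fun f hf => ?_
  have hfs : Measurable fun z => f (shares leader e A z) := hf.comp (measurable_shares he A)
  rw [lintegral_map hf (measurable_shares he A), lintegral_map hf (measurable_shares he A),
    lintegral_prod _ hfs.aemeasurable, lintegral_prod _ hfs.aemeasurable,
    lintegral_map hfs.lintegral_prod_right' (measurable_forget A)]
  refine lintegral_congr fun s => ?_
  obtain ⟨t, ht⟩ := exists_shares_add_eq_shares_forget e leader A s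
  rw [← lintegral_add_left_eq_self _ t]
  simp only [ht]

lemma map_shares_withDensity_prod_noise [Nonempty E] [ν.IsAddLeftInvariant] (he : Measurable e)
    {P : Measure (Finset ι → E)} [SFinite P] {A : Finset ι} {g g' : (Finset ι → E) → ℝ≥0∞}
    (hg : Measurable g) (hg' : Measurable g')
    (h : (P.withDensity g).map (forget A) = (P.withDensity g').map (forget A)) :
    ((P.prod (noise ι ν)).withDensity fun z => g z.1).map (shares leader e A) =
      ((P.prod (noise ι ν)).withDensity fun z => g' z.1).map (shares leader e A) := by
  rw [← prod_withDensity_left hg, ← prod_withDensity_left hg', map_shares_prod_noise he, h,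
    ← map_shares_prod_noise he]

end Secrecy

/-! ### Outputs of a channel -/

section OutputEntropy

variable {𝒳 β : Type*} [Fintype 𝒳] {w : 𝒳 → PMF β}

/-- The probability of the output `b` of the channel `w` when the input has distribution `π`. -/
def outputProb (w : 𝒳 → PMF β) (π : 𝒳 → ℝ) (b : β) : ℝ := ∑ x, π x * (w x b).toReal

lemma outputProb_mem_Icc (π : stdSimplex ℝ 𝒳) (b : β) : outputProb w π b ∈ Set.Icc 0 1 := by
  refine ⟨Finset.sum_nonneg fun x _ => mul_nonneg (stdSimplex.zero_le π x) ENNReal.toReal_nonneg,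
    (Finset.sum_le_sum fun x _ => mul_le_of_le_one_right (stdSimplex.zero_le π x) ?_).trans
      (stdSimplex.sum_eq_one π).le⟩
  exact ENNReal.toReal_le_of_le_ofReal zero_le_one ((w x).coe_le_one b |>.trans (by simp))

lemma ofReal_outputProb (π : stdSimplex ℝ 𝒳) (b : β) :
    ENNReal.ofReal (outputProb w π b) = ∑ x, ENNReal.ofReal (π x) * w x b := by
  rw [outputProb, ENNReal.ofReal_sum_of_nonneg fun x _ =>
    mul_nonneg (stdSimplex.zero_le π x) ENNReal.toReal_nonneg]
  refine Finset.sum_congr rfl fun x _ => ?_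
  rw [ENNReal.ofReal_mul (stdSimplex.zero_le π x), ENNReal.ofReal_toReal ((w x).apply_ne_top b)]

variable [Fintype β]

/-- Entropy of the output of the channel `w` when the input has distribution `π`. -/
def outEntropy (w : 𝒳 → PMF β) (π : 𝒳 → ℝ) : ℝ := ∑ b, Real.negMulLog (outputProb w π b)

lemma continuous_outEntropy (w : 𝒳 → PMF β) : Continuous (outEntropy w) := by
  unfold outEntropy outputProb
  exact continuous_finsetSum _ fun b _ => Real.continuous_negMulLog.comp (by fun_prop)

lemma outEntropy_nonneg (w : 𝒳 → PMF β) (π : stdSimplex ℝ 𝒳) : 0 ≤ outEntropy w π :=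
  Finset.sum_nonneg fun b _ =>
    Real.negMulLog_nonneg (outputProb_mem_Icc π b).1 (outputProb_mem_Icc π b).2

lemma ofReal_outEntropy (w : 𝒳 → PMF β) (π : stdSimplex ℝ 𝒳) :
    ENNReal.ofReal (outEntropy w π) =
      ∑ b, ENNReal.ofReal (Real.negMulLog (outputProb w π b)) :=
  ENNReal.ofReal_sum_of_nonneg fun b _ =>
    Real.negMulLog_nonneg (outputProb_mem_Icc π b).1 (outputProb_mem_Icc π b).2

end OutputEntropy

section Joint

lemma measurable_ofReal_apply {𝒳 Z : Type*} [Fintype 𝒳]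
    [MeasurableSpace Z] {π : Z → stdSimplex ℝ 𝒳} (hπ : Measurable π) (x : 𝒳) :
    Measurable fun z => ENNReal.ofReal (π z x) :=
  ((measurable_pi_apply x).comp (measurable_subtype_coe.comp hπ)).ennreal_ofReal

variable {𝒳 β Z Ω : Type*} [Fintype 𝒳] [MeasurableSpace 𝒳] [MeasurableSpace β]
  [MeasurableSpace Z] [MeasurableSpace Ω] {w : 𝒳 → PMF β} {Q : Measure Z}
  {π : Z → stdSimplex ℝ 𝒳} {μ : Measure Ω} {D : Ω → Z} {X : Ω → 𝒳} {Y : Ω → β}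

/-- `D` has distribution `Q`, the input `X` has the distribution `π D` given `D`, and `Y` is the
output of the channel `w` with input `X`, so that `D → X → Y` is a Markov chain. -/
structure IsJoint (w : 𝒳 → PMF β) (Q : Measure Z) (π : Z → stdSimplex ℝ 𝒳) (μ : Measure Ω)
    (D : Ω → Z) (X : Ω → 𝒳) (Y : Ω → β) : Prop where
  measurable_D : Measurable D
  measurable_X : Measurable X
  measurable_Y : Measurable Y
  measure_inter : ∀ s, MeasurableSet s → ∀ t, MeasurableSet t → ∀ x,
    μ (D ⁻¹' s ∩ X ⁻¹' {x} ∩ Y ⁻¹' t) =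
      Q.withDensity (fun z => ENNReal.ofReal (π z x)) s * (w x).toMeasure t

lemma exists_measurePreserving_real {T : Type*} [MeasurableSpace T] [StandardBorelSpace T]
    [Nonempty T] (J : Measure T) :
    ∃ (μ : Measure ℝ) (f : ℝ → T), MeasurePreserving f μ J := by
  have hemb := measurableEmbedding_embeddingReal T
  refine ⟨J.map (embeddingReal T), hemb.invFun, hemb.measurable_invFun, ?_⟩
  rw [Measure.map_map hemb.measurable_invFun hemb.measurable, hemb.leftInverse_invFun.comp_eq_id,
    Measure.map_id]

lemma exists_isJoint [StandardBorelSpace Z] [Nonempty Z] [MeasurableSingletonClass 𝒳] [Nonempty 𝒳]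
    [StandardBorelSpace β] [Nonempty β] (w : 𝒳 → PMF β) (Q : Measure Z) [SFinite Q]
    (π : Z → stdSimplex ℝ 𝒳) :
    ∃ (μ : Measure ℝ) (D : ℝ → Z) (X : ℝ → 𝒳) (Y : ℝ → β), IsJoint w Q π μ D X Y := by
  classical
  let J : Measure (Z × 𝒳 × β) := ∑ x, (Q.withDensity fun z => ENNReal.ofReal (π z x)).prod
    ((Measure.dirac x).prod (w x).toMeasure)
  obtain ⟨μ, f, hf⟩ := exists_measurePreserving_real J
  refine ⟨μ, fun ω => (f ω).1, fun ω => (f ω).2.1, fun ω => (f ω).2.2, hf.measurable.fst,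
    hf.measurable.snd.fst, hf.measurable.snd.snd, fun s hs t ht x => ?_⟩
  have hpreimage : (fun ω => (f ω).1) ⁻¹' s ∩ (fun ω => (f ω).2.1) ⁻¹' {x} ∩
      (fun ω => (f ω).2.2) ⁻¹' t = f ⁻¹' (s ×ˢ {x} ×ˢ t) := by
    ext ω
    simp [and_assoc]
  have hprod : MeasurableSet (s ×ˢ {x} ×ˢ t) := hs.prod ((measurableSet_singleton x).prod ht)
  rw [hpreimage, hf.measure_preimage hprod.nullMeasurableSet, Measure.finsetSum_apply,
    Finset.sum_eq_single_of_mem x (Finset.mem_univ x)]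
  · simp [Measure.prod_prod]
  · intro x' _ hx'
    simp [Measure.prod_prod, hx']

namespace IsJoint

lemma comp {β' : Type*} [MeasurableSpace β'] {f : β → β'} (h : IsJoint w Q π μ D X Y)
    (hf : Measurable f) : IsJoint (fun x => (w x).map f) Q π μ D X (fun ω => f (Y ω)) where
  measurable_D := h.measurable_D
  measurable_X := h.measurable_X
  measurable_Y := hf.comp h.measurable_Y
  measure_inter s hs t ht x := by
    rw [PMF.toMeasure_map_apply f (w x) t hf ht]
    exact h.measure_inter s hs _ (hf ht) x

lemma measure_inter_singleton [MeasurableSingletonClass β] (h : IsJoint w Q π μ D X Y) {s : Set Z}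
    (hs : MeasurableSet s) (x : 𝒳) (y : β) :
    μ (D ⁻¹' s ∩ X ⁻¹' {x} ∩ Y ⁻¹' {y}) = μ (D ⁻¹' s ∩ X ⁻¹' {x}) * w x y := by
  have hinput := h.measure_inter s hs Set.univ MeasurableSet.univ x
  rw [Set.preimage_univ, Set.inter_univ, measure_univ, mul_one] at hinput
  rw [hinput, h.measure_inter s hs _ (measurableSet_singleton y) x,
    PMF.toMeasure_apply_singleton _ _ (measurableSet_singleton y)]

lemma measure_output [MeasurableSingletonClass 𝒳] (h : IsJoint w Q π μ D X Y) {s : Set Z}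
    (hs : MeasurableSet s) {t : Set β} (ht : MeasurableSet t) :
    μ (D ⁻¹' s ∩ Y ⁻¹' t) =
      ∑ x, Q.withDensity (fun z => ENNReal.ofReal (π z x)) s * (w x).toMeasure t := by
  have hinput : ∀ x, MeasurableSet (X ⁻¹' {x}) := fun x =>
    h.measurable_X (measurableSet_singleton x)
  have hpartition := sum_measure_preimage_singleton (μ := μ.restrict (D ⁻¹' s ∩ Y ⁻¹' t))
    Finset.univ fun x _ => hinput x
  rw [Finset.coe_univ, Set.preimage_univ, Measure.restrict_apply_univ] at hpartition
  rw [← hpartition]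
  refine Finset.sum_congr rfl fun x _ => ?_
  rw [Measure.restrict_apply (hinput x), ← h.measure_inter s hs t ht x, Set.inter_right_comm,
    Set.inter_comm]

lemma measurePreserving [MeasurableSingletonClass 𝒳] (h : IsJoint w Q π μ D X Y)
    (hπ : Measurable π) : MeasurePreserving D μ Q := by
  refine ⟨h.measurable_D, Measure.ext fun s hs => ?_⟩
  have hsum : ∀ z, ∑ x, ENNReal.ofReal (π z x) = 1 := fun z => by
    rw [← ENNReal.ofReal_sum_of_nonneg fun x _ => stdSimplex.zero_le (π z) x,
      stdSimplex.sum_eq_one (π z), ENNReal.ofReal_one]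
  have houtput := h.measure_output hs MeasurableSet.univ
  simp only [Set.preimage_univ, Set.inter_univ, measure_univ, mul_one, withDensity_apply _ hs]
    at houtput
  rw [Measure.map_apply h.measurable_D hs, houtput,
    ← lintegral_finsetSum _ fun x _ => measurable_ofReal_apply hπ x]
  simp only [hsum, lintegral_one, Measure.restrict_apply_univ]

lemma condEntropy_comp {γ : Type*} [MeasurableSpace γ] [MeasurableSingletonClass 𝒳] [Fintype β]
    [Nonempty β] [MeasurableSingletonClass β] [IsFiniteMeasure μ] (h : IsJoint w Q π μ D X Y)
    (hπ : Measurable π) {c : Z → γ} (hc : Measurable c) {d : γ → stdSimplex ℝ 𝒳}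
    (hd : Measurable d)
    (hcd : ∀ x, (Q.withDensity fun z => ENNReal.ofReal (π z x)).map c =
      (Q.withDensity fun z => ENNReal.ofReal (d (c z) x)).map c) :
    condEntropy μ Y (fun ω => c (D ω)) = ∫⁻ z, ENNReal.ofReal (outEntropy w (d (c z))) ∂Q := by
  have hD := h.measurePreserving hπ
  have happly : ∀ x, Measurable fun z => ENNReal.ofReal (d (c z) x) :=
    measurable_ofReal_apply (hd.comp hc)
  have hentropy : Measurable fun z => ENNReal.ofReal (outEntropy w (d (c z))) :=
    ((continuous_outEntropy w).measurable.comp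
      (measurable_subtype_coe.comp (hd.comp hc))).ennreal_ofReal
  have hprob : ∀ b, Measurable fun g => ENNReal.ofReal (outputProb w (d g) b) := fun b => by
    have happly := measurable_ofReal_apply hd
    simp only [ofReal_outputProb]
    fun_prop
  rw [condEntropy_eq_lintegral (C := fun ω => c (D ω)) h.measurable_Y
    (hc.comp h.measurable_D) hprob]
  · rw [← hD.lintegral_comp hentropy]
    refine lintegral_congr fun ω => ?_
    simp only [ofReal_outEntropy, ENNReal.toReal_ofReal (outputProb_mem_Icc (d _) _).1]
  · intro s hs b
    have hposterior : ∀ x, Q.withDensity (fun z => ENNReal.ofReal (π z x)) (c ⁻¹' s) =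
        ∫⁻ z in c ⁻¹' s, ENNReal.ofReal (d (c z) x) ∂Q := fun x => by
      rw [← withDensity_apply _ (hc hs), ← Measure.map_apply hc hs, hcd,
        Measure.map_apply hc hs]
    calc μ ((fun ω => c (D ω)) ⁻¹' s ∩ Y ⁻¹' {b})
        = ∑ x, (∫⁻ z in c ⁻¹' s, ENNReal.ofReal (d (c z) x) ∂Q) * w x b := by
          simp only [← hposterior, ← PMF.toMeasure_apply_singleton _ b (measurableSet_singleton b)]
          exact h.measure_output (hc hs) (measurableSet_singleton b)
      _ = ∫⁻ z in c ⁻¹' s, ENNReal.ofReal (outputProb w (d (c z)) b) ∂Q := by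
          simp only [ofReal_outputProb]
          rw [lintegral_finsetSum _ fun x _ => (happly x).mul_const _]
          exact Finset.sum_congr rfl fun x _ => (lintegral_mul_const _ (happly x)).symm
      _ = ∫⁻ ω in (fun ω => c (D ω)) ⁻¹' s, ENNReal.ofReal (outputProb w (d (c (D ω))) b) ∂μ :=
          (hD.setLIntegral_comp_preimage (hc hs) ((hprob b).comp hc)).symm

end IsJoint

end Joint

/-! ### Coherent posteriors -/

section Coherent

variable {ι 𝒳 β : Type*} [Fintype 𝒳]

/-- For each set of parties, a distribution of the channel input: the posterior given what these
parties know. -/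
abbrev Posteriors (ι 𝒳 : Type*) [Fintype 𝒳] : Type _ := Finset ι → stdSimplex ℝ 𝒳

/-- Average output entropy given what the parties in `S` know. -/
def meanEntropy [Fintype β] (w : 𝒳 → PMF β) (P : Measure (Posteriors ι 𝒳)) (S : Finset ι) : ℝ :=
  ∫ κ, outEntropy w (κ S) ∂P

lemma meanEntropy_nonneg [Fintype β] (w : 𝒳 → PMF β) (P : Measure (Posteriors ι 𝒳)) (S : Finset ι) :
    0 ≤ meanEntropy w P S :=
  integral_nonneg fun κ => outEntropy_nonneg w (κ S)

lemma continuous_posterior_apply (S : Finset ι) (x : 𝒳) :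
    Continuous fun κ : Posteriors ι 𝒳 => κ S x :=
  (continuous_apply x).comp (continuous_subtype_val.comp (continuous_apply S))

lemma continuous_outEntropy_posterior [Fintype β] (w : 𝒳 → PMF β) (S : Finset ι) :
    Continuous fun κ : Posteriors ι 𝒳 => outEntropy w (κ S) :=
  (continuous_outEntropy w).comp (continuous_subtype_val.comp (continuous_apply S))

variable [Fintype ι] [DecidableEq ι] [Nonempty 𝒳]

/-- The posteriors are consistent: given the posteriors of all subsets of `A`, the input has the
distribution `κ A`. Here the input has the distribution `κ univ` given all posteriors. -/
def Coherent (P : Measure (Posteriors ι 𝒳)) : Prop :=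
  ∀ (A : Finset ι) (x : 𝒳),
    (P.withDensity fun κ => ENNReal.ofReal (κ Finset.univ x)).map (forget A) =
      (P.withDensity fun κ => ENNReal.ofReal (κ A x)).map (forget A)

lemma integral_map_withDensity_ofReal {Ω Ω' : Type*} [MeasurableSpace Ω] [MeasurableSpace Ω']
    (P : Measure Ω) {f : Ω → ℝ} (hf : Measurable f) (hf0 : ∀ ω, 0 ≤ f ω) {φ : Ω → Ω'}
    (hφ : Measurable φ) {g : Ω' → ℝ} (hg : Measurable g) :
    ∫ x, g x ∂((P.withDensity fun ω => ENNReal.ofReal (f ω)).map φ) =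
      ∫ ω, f ω * g (φ ω) ∂P := by
  rw [integral_map hφ.aemeasurable hg.aestronglyMeasurable,
    integral_withDensity_eq_integral_toReal_smul hf.ennreal_ofReal
      (ae_of_all _ fun _ => ENNReal.ofReal_lt_top)]
  simp only [ENNReal.toReal_ofReal (hf0 _), smul_eq_mul]

lemma coherent_iff_integral_eq {P : Measure (Posteriors ι 𝒳)} [IsFiniteMeasure P] :
    Coherent P ↔ ∀ (A : Finset ι) (x : 𝒳) (g : C(Posteriors ι 𝒳, ℝ)),
      ∫ κ, κ Finset.univ x * g (forget A κ) ∂P = ∫ κ, κ A x * g (forget A κ) ∂P := by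
  refine forall₂_congr fun A x => ?_
  have hintegral : ∀ B (g : C(Posteriors ι 𝒳, ℝ)),
      ∫ κ, g κ ∂((P.withDensity fun κ => ENNReal.ofReal (κ B x)).map (forget A)) =
        ∫ κ, κ B x * g (forget A κ) ∂P := fun B g =>
    integral_map_withDensity_ofReal P (continuous_posterior_apply B x).measurable
      (fun κ => stdSimplex.zero_le (κ B) x) (measurable_forget A) g.continuous.measurable
  have hfinite : ∀ B, IsFiniteMeasure
      ((P.withDensity fun κ => ENNReal.ofReal (κ B x)).map (forget A)) := fun B => by
    have : IsFiniteMeasure (P.withDensity fun κ => ENNReal.ofReal (κ B x)) :=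
      isFiniteMeasure_withDensity_ofReal
        ((continuous_posterior_apply B x).integrable_of_hasCompactSupport
          (HasCompactSupport.of_compactSpace _)).2
    exact Measure.isFiniteMeasure_map _ _
  simp only [← hintegral]
  refine ⟨fun h g => by rw [h], fun h => ?_⟩
  have := hfinite
  exact ext_of_forall_integral_eq_of_IsFiniteMeasure fun g => h g.toContinuousMap

end Coherent

/-! ### Observations of the parties -/

section Observation

variable {ι E G : Type*} [DecidableEq ι] [AddCommGroup G] {leader : Finset ι → ι}
  {e : E → G} {A B : Finset ι}

lemma measurable_finset_piecewise {Z T : Type*} [MeasurableSpace Z] [MeasurableSpace T]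
    {f g : Z → ι → T} (A : Finset ι) (hf : Measurable f) (hg : Measurable g) :
    Measurable fun z => A.piecewise (f z) (g z) := by
  refine measurable_pi_lambda _ fun i => ?_
  unfold Finset.piecewise
  split_ifs <;> fun_prop

section Observes

variable [MeasurableSpace G] {γ δ : Type*} [MeasurableSpace γ] [MeasurableSpace δ]

/-- The variable `c` carries the same information as the shares of the parties in `A`. -/
def Observes (leader : Finset ι → ι) (e : E → G) (A : Finset ι)
    (c : (Finset ι → E) × (ι → Finset ι → G) → γ) : Prop :=
  ∃ (φ : (ι → Finset ι → G) → γ) (ψ : γ → ι → Finset ι → G), Measurable φ ∧ Measurable ψ ∧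
    (∀ z, c z = φ (shares leader e A z)) ∧ ∀ z, shares leader e A z = ψ (c z)

lemma Observes.prodMk {c : (Finset ι → E) × (ι → Finset ι → G) → γ}
    {d : (Finset ι → E) × (ι → Finset ι → G) → δ} (hc : Observes leader e A c)
    (hd : Observes leader e B d) : Observes leader e (A ∪ B) fun z => (c z, d z) := by
  obtain ⟨φ, ψ, hφ, hψ, hcφ, hcψ⟩ := hc
  obtain ⟨φ', ψ', hφ', hψ', hdφ, hdψ⟩ := hd
  refine ⟨fun s => (φ (A.piecewise s 0), φ' (B.piecewise s 0)),
    fun x => A.piecewise (ψ x.1) (ψ' x.2),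
    (hφ.comp (measurable_finset_piecewise A measurable_id measurable_const)).prodMk
      (hφ'.comp (measurable_finset_piecewise B measurable_id measurable_const)),
    measurable_finset_piecewise A (hψ.comp measurable_fst) (hψ'.comp measurable_snd),
    fun z => ?_, fun z => ?_⟩
  · simp only
    rw [hcφ, hdφ, shares_eq_piecewise e (A := A) (B := A ∪ B) Finset.subset_union_left,
      shares_eq_piecewise e (A := B) (B := A ∪ B) Finset.subset_union_right]
  · simp only [← hcψ, ← hdψ]
    ext i S
    by_cases hA : i ∈ A <;> simp [shares, hA]

variable [MeasurableSpace E] [MeasurableAdd₂ G]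

lemma Observes.exists_decode [Nonempty E] {c : (Finset ι → E) × (ι → Finset ι → G) → γ}
    (hc : Observes leader e A c) (he : MeasurableEmbedding e) (hA : leader A ∈ A) :
    ∃ d : γ → E, Measurable d ∧ ∀ z, d (c z) = z.1 A := by
  obtain ⟨φ, ψ, -, hψ, -, hcψ⟩ := hc
  refine ⟨fun g => he.invFun (∑ i ∈ A, ψ g i A), he.measurable_invFun.comp ?_, fun z => ?_⟩
  · fun_prop
  · simp only [← hcψ, sum_shares e hA, he.leftInverse_invFun _]

variable [MeasurableSub₂ G]

lemma Observes.measurable {c : (Finset ι → E) × (ι → Finset ι → G) → γ}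
    (hc : Observes leader e A c) (he : Measurable e) : Measurable c := by
  obtain ⟨φ, ψ, hφ, -, hcφ, -⟩ := hc
  rw [funext hcφ]
  exact hφ.comp (measurable_shares he A)

end Observes

variable [Fintype ι] [MeasurableSpace G] [StandardBorelSpace G]

/-- The shares of party `i` as a real number. -/
def party (leader : Finset ι → ι) (e : E → G) (i : ι)
    (z : (Finset ι → E) × (ι → Finset ι → G)) : ℝ :=
  embeddingReal (Finset ι → G) (shares leader e Finset.univ z i)

lemma observes_party (i : ι) : Observes leader e {i} (party leader e i) := by
  have hemb := measurableEmbedding_embeddingReal (Finset ι → G)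
  refine ⟨fun s => embeddingReal _ (s i), fun r => ({i} : Finset ι).piecewise
    (fun _ => hemb.invFun r) 0, hemb.measurable.comp (measurable_pi_apply i),
    measurable_finset_piecewise _ (measurable_pi_lambda _ fun _ => hemb.measurable_invFun)
      measurable_const, fun z => ?_, fun z => ?_⟩
  · rw [shares_eq_piecewise e (Finset.subset_univ {i}), party]
    simp
  · beta_reduce
    rw [shares_eq_piecewise e (A := {i}) (Finset.subset_univ _), party, hemb.leftInverse_invFun]
    exact Finset.piecewise_congr _ (fun j hj => by rw [Finset.mem_singleton.1 hj]) fun _ _ => rfl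

variable [MeasurableSpace E]

lemma indepFun_party {i j : ι} (hij : i ≠ j) (hi : ∀ S, i ≠ leader S) (hj : ∀ S, j ≠ leader S)
    (P : Measure (Finset ι → E)) [IsProbabilityMeasure P] {ν : Measure G}
    [IsProbabilityMeasure ν] :
    IndepFun (party leader e i) (party leader e j) (P.prod (noise ι ν)) :=
  (indepFun_shares hij hi hj P).comp (measurableEmbedding_embeddingReal _).measurable
    (measurableEmbedding_embeddingReal _).measurable

end Observation

section ObservedEntropy

variable {ι 𝒳 β G γ Ω : Type*} [Fintype ι] [DecidableEq ι] [Fintype 𝒳] [Nonempty 𝒳]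
  [MeasurableSpace 𝒳] [MeasurableSingletonClass 𝒳] [Fintype β] [Nonempty β] [MeasurableSpace β]
  [MeasurableSingletonClass β] [AddCommGroup G] [MeasurableSpace G] [MeasurableAdd₂ G]
  [MeasurableSub₂ G] [MeasurableSpace γ] [MeasurableSpace Ω] {ν : Measure G}
  [IsProbabilityMeasure ν] [ν.IsAddLeftInvariant] {w : 𝒳 → PMF β} {P : Measure (Posteriors ι 𝒳)}
  [IsProbabilityMeasure P] {μ : Measure Ω} [IsFiniteMeasure μ]
  {D : Ω → Posteriors ι 𝒳 × (ι → Finset ι → G)} {X : Ω → 𝒳} {Y : Ω → β}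
  {leader : Finset ι → ι} {e : stdSimplex ℝ 𝒳 → G} {A B : Finset ι}
  {c : Posteriors ι 𝒳 × (ι → Finset ι → G) → γ}

lemma condEntropy_observation
    (h : IsJoint w (P.prod (noise ι ν)) (fun z => z.1 Finset.univ) μ D X Y) (hP : Coherent P)
    (he : MeasurableEmbedding e) (hA : leader A ∈ A) (hc : Observes leader e A c) :
    condEntropy μ Y (fun ω => c (D ω)) = ENNReal.ofReal (meanEntropy w P A) := by
  have hcm := hc.measurable he.measurable
  obtain ⟨d, hd, hdc⟩ := hc.exists_decode he hA
  obtain ⟨φ, -, hφ, -, hcφ, -⟩ := hc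
  have hposterior : ∀ S x, Measurable fun κ : Posteriors ι 𝒳 => ENNReal.ofReal (κ S x) :=
    fun S x => (continuous_posterior_apply S x).measurable.ennreal_ofReal
  have hshares := measurable_shares (leader := leader) he.measurable A
  rw [h.condEntropy_comp (by fun_prop) hcm hd fun x => ?_]
  · have hcont := continuous_outEntropy_posterior w A
    simp only [hdc]
    rw [lintegral_prod (fun z : Posteriors ι 𝒳 × (ι → Finset ι → G) =>
        ENNReal.ofReal (outEntropy w (z.1 A)))
        (hcont.measurable.comp measurable_fst).ennreal_ofReal.aemeasurable, meanEntropy,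
      ofReal_integral_eq_lintegral_ofReal
        (hcont.integrable_of_hasCompactSupport (HasCompactSupport.of_compactSpace _))
        (ae_of_all _ fun κ => outEntropy_nonneg w (κ A))]
    simp only [lintegral_const, measure_univ, mul_one]
  · simp only [hdc]
    rw [show c = φ ∘ shares leader e A from funext hcφ, ← Measure.map_map hφ hshares,
      ← Measure.map_map hφ hshares, map_shares_withDensity_prod_noise he.measurable
        (hposterior Finset.univ x) (hposterior A x) (hP A x)]

variable [StandardBorelSpace G]

lemma condMutualInfo_party_add_meanEntropy
    (h : IsJoint w (P.prod (noise ι ν)) (fun z => z.1 Finset.univ) μ D X Y) (hP : Coherent P)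
    (he : MeasurableEmbedding e) (hA : leader A ∈ A) (hB : leader B ∈ B) {i : ι}
    (hAB : A ∪ {i} = B) (hc : Observes leader e A c) :
    condMutualInfo μ (fun ω => party leader e i (D ω)) Y (fun ω => c (D ω)) +
      ENNReal.ofReal (meanEntropy w P B) = ENNReal.ofReal (meanEntropy w P A) := by
  have hcB : Observes leader e B fun z => (c z, party leader e i z) :=
    hAB ▸ hc.prodMk (observes_party i)
  rw [← condEntropy_observation h hP he hA hc, ← condEntropy_observation h hP he hB hcB]
  exact condMutualInfo_add_condEntropy
    (((observes_party i).measurable he.measurable).comp h.measurable_D) h.measurable_Y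
    ((hc.measurable he.measurable).comp h.measurable_D)

lemma condMutualInfo_party
    (h : IsJoint w (P.prod (noise ι ν)) (fun z => z.1 Finset.univ) μ D X Y) (hP : Coherent P)
    (he : MeasurableEmbedding e) (hA : leader A ∈ A) (hB : leader B ∈ B) {i : ι}
    (hAB : A ∪ {i} = B) (hc : Observes leader e A c) :
    condMutualInfo μ (fun ω => party leader e i (D ω)) Y (fun ω => c (D ω)) =
      ENNReal.ofReal (meanEntropy w P A - meanEntropy w P B) := by
  rw [ENNReal.ofReal_sub _ (meanEntropy_nonneg w P B)]
  exact ENNReal.eq_sub_of_add_eq ENNReal.ofReal_ne_top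
    (condMutualInfo_party_add_meanEntropy h hP he hA hB hAB hc)

lemma meanEntropy_le
    (h : IsJoint w (P.prod (noise ι ν)) (fun z => z.1 Finset.univ) μ D X Y) (hP : Coherent P)
    (he : MeasurableEmbedding e) (hA : leader A ∈ A) (hB : leader B ∈ B) {i : ι}
    (hAB : A ∪ {i} = B) (hc : Observes leader e A c) :
    meanEntropy w P B ≤ meanEntropy w P A :=
  (ENNReal.ofReal_le_ofReal_iff (meanEntropy_nonneg w P A)).1
    (le_add_self.trans_eq (condMutualInfo_party_add_meanEntropy h hP he hA hB hAB hc))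

end ObservedEntropy

/-! ### The outer bound from posteriors -/

lemma exists_measurableEmbedding_circle (E : Type*) [MeasurableSpace E] [StandardBorelSpace E] :
    ∃ e : E → UnitAddCircle, MeasurableEmbedding e := by
  have hcircle : ¬ Countable UnitAddCircle := fun h => by
    have := Cardinal.mk_le_aleph0_iff.2 ((AddCircle.equivIco (1 : ℝ) 0).symm.countable_iff.2 h)
    rw [Cardinal.mk_Ico_real (by norm_num)] at this
    exact this.not_gt Cardinal.aleph0_lt_continuum
  exact ⟨_, (PolishSpace.measurableEquivOfNotCountable
    (not_countable_iff.2 inferInstance) hcircle).measurableEmbedding.comp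
      (measurableEmbedding_embeddingReal E)⟩

section OuterBound

variable {𝒳 𝒴₁ 𝒴₂ : Type*} [Fintype 𝒳] [Fintype 𝒴₁] [Fintype 𝒴₂]

/-- Average entropy of the first output given what the parties in `S` know. -/
abbrev meanEntropy₁ (p : 𝒳 → PMF (𝒴₁ × 𝒴₂)) (P : Measure (Posteriors (Fin 4) 𝒳)) :
    Finset (Fin 4) → ℝ :=
  meanEntropy (fun x => (p x).map Prod.fst) P

/-- Average entropy of the second output given what the parties in `S` know. -/
abbrev meanEntropy₂ (p : 𝒳 → PMF (𝒴₁ × 𝒴₂)) (P : Measure (Posteriors (Fin 4) 𝒳)) :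
    Finset (Fin 4) → ℝ :=
  meanEntropy (fun x => (p x).map Prod.snd) P

variable [Nonempty 𝒳]

/-- The distribution `P` of the posteriors satisfies the conditions of the outer bound for the rate
pair `R` up to `η`. The parties `0`, `1`, `2`, `3` are `U`, `V`, `W₁`, `W₂`. -/
structure ApproxAdmissible (p : 𝒳 → PMF (𝒴₁ × 𝒴₂)) (R : ℝ × ℝ) (η : ℝ)
    (P : Measure (Posteriors (Fin 4) 𝒳)) : Prop where
  coherent : Coherent P
  sum_identity : ∀ J ⊆ {0, 1}, meanEntropy₁ p P (J ∪ {2}) - meanEntropy₁ p P (J ∪ {2, 3}) =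
    meanEntropy₂ p P (J ∪ {3}) - meanEntropy₂ p P (J ∪ {2, 3})
  abs_fst_le : |meanEntropy₁ p P {2} - meanEntropy₁ p P {0, 2} -
    (meanEntropy₁ p P {1, 2} - meanEntropy₁ p P {0, 1, 2})| ≤ η
  abs_snd_le : |meanEntropy₂ p P {3} - meanEntropy₂ p P {1, 3} -
    (meanEntropy₂ p P {0, 3} - meanEntropy₂ p P {0, 1, 3})| ≤ η
  rate_fst_le : R.1 ≤ meanEntropy₁ p P {2} - meanEntropy₁ p P {0, 2} + η
  rate_snd_le : R.2 ≤ meanEntropy₂ p P {3} - meanEntropy₂ p P {1, 3} + η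

lemma ApproxAdmissible.message_diff {p : 𝒳 → PMF (𝒴₁ × 𝒴₂)} {R : ℝ × ℝ}
    {P : Measure (Posteriors (Fin 4) 𝒳)} (hP : ApproxAdmissible p R 0 P) :
    meanEntropy₁ p P {1, 2, 3} - meanEntropy₁ p P {0, 1, 2, 3} +
        (meanEntropy₂ p P {2, 3} - meanEntropy₂ p P {0, 2, 3}) =
      meanEntropy₂ p P {1, 2, 3} - meanEntropy₂ p P {0, 1, 2, 3} +
        (meanEntropy₁ p P {2, 3} - meanEntropy₁ p P {0, 2, 3}) := by
  have hnone : meanEntropy₁ p P {2} - meanEntropy₁ p P {2, 3} =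
    meanEntropy₂ p P {3} - meanEntropy₂ p P {2, 3} := hP.sum_identity ∅ (by decide)
  have hU : meanEntropy₁ p P {0, 2} - meanEntropy₁ p P {0, 2, 3} =
    meanEntropy₂ p P {0, 3} - meanEntropy₂ p P {0, 2, 3} := hP.sum_identity {0} (by decide)
  have hV : meanEntropy₁ p P {1, 2} - meanEntropy₁ p P {1, 2, 3} =
    meanEntropy₂ p P {1, 3} - meanEntropy₂ p P {1, 2, 3} := hP.sum_identity {1} (by decide)
  have hUV : meanEntropy₁ p P {0, 1, 2} - meanEntropy₁ p P {0, 1, 2, 3} =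
    meanEntropy₂ p P {0, 1, 3} - meanEntropy₂ p P {0, 1, 2, 3} :=
    hP.sum_identity {0, 1} (by decide)
  linarith [abs_nonpos_iff.1 hP.abs_fst_le, abs_nonpos_iff.1 hP.abs_snd_le]

end OuterBound

section Realization

/-- The member of a set of parties who completes the shares: never `U` or `V`, so that these two
hold independent noise only. -/
def auxiliaryLeader (S : Finset (Fin 4)) : Fin 4 :=
  if 2 ∈ S then 2 else 3

lemma ne_auxiliaryLeader {i : Fin 4} (hi : i ∈ ({0, 1} : Finset (Fin 4))) (S : Finset (Fin 4)) :
    i ≠ auxiliaryLeader S := by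
  revert i S; decide

lemma auxiliaryLeader_mem {A : Finset (Fin 4)} (hA : ¬ A ⊆ {0, 1}) : auxiliaryLeader A ∈ A := by
  revert A; decide

/-- The uniform noise from which the shares of the parties are made. -/
abbrev circleNoise : Measure (Fin 4 → Finset (Fin 4) → UnitAddCircle) :=
  noise (Fin 4) AddCircle.haarAddCircle

variable {𝒳 𝒴 𝒴' Ω γ γ' : Type*} [Fintype 𝒳] [Nonempty 𝒳] [MeasurableSpace 𝒳]
  [MeasurableSingletonClass 𝒳] [Fintype 𝒴] [Nonempty 𝒴] [MeasurableSpace 𝒴]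
  [MeasurableSingletonClass 𝒴] [Fintype 𝒴'] [Nonempty 𝒴'] [MeasurableSpace 𝒴']
  [MeasurableSingletonClass 𝒴'] [MeasurableSpace Ω] [MeasurableSpace γ] [MeasurableSpace γ']
  {w : 𝒳 → PMF 𝒴} {w' : 𝒳 → PMF 𝒴'} {P : Measure (Posteriors (Fin 4) 𝒳)}
  [IsProbabilityMeasure P] {μ : Measure Ω} [IsFiniteMeasure μ] {X : Ω → 𝒳} {Y : Ω → 𝒴}
  {Y' : Ω → 𝒴'} {D : Ω → Posteriors (Fin 4) 𝒳 × (Fin 4 → Finset (Fin 4) → UnitAddCircle)}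
  {e : stdSimplex ℝ 𝒳 → UnitAddCircle} {A A' B B' : Finset (Fin 4)}
  {c : Posteriors (Fin 4) 𝒳 × (Fin 4 → Finset (Fin 4) → UnitAddCircle) → γ}
  {c' : Posteriors (Fin 4) 𝒳 × (Fin 4 → Finset (Fin 4) → UnitAddCircle) → γ'}

/-- The auxiliary random variables `U`, `V`, `W₁`, `W₂`, for `i = 0, 1, 2, 3`. -/
abbrev auxiliary (e : stdSimplex ℝ 𝒳 → UnitAddCircle)
    (D : Ω → Posteriors (Fin 4) 𝒳 × (Fin 4 → Finset (Fin 4) → UnitAddCircle)) (i : Fin 4) :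
    Ω → ℝ :=
  fun ω => party auxiliaryLeader e i (D ω)

lemma condMutualInfo_auxiliary
    (h : IsJoint w (P.prod circleNoise) (fun z => z.1 Finset.univ) μ D X Y) (hP : Coherent P)
    (he : MeasurableEmbedding e) (hc : Observes auxiliaryLeader e A c) (i : Fin 4)
    (hA : ¬ A ⊆ {0, 1}) (hB : A ∪ {i} = B) :
    condMutualInfo μ (auxiliary e D i) Y (fun ω => c (D ω)) =
      ENNReal.ofReal (meanEntropy w P A - meanEntropy w P B) :=
  condMutualInfo_party h hP he (auxiliaryLeader_mem hA)
    (auxiliaryLeader_mem fun h => hA (Finset.subset_union_left.trans (hB.subset.trans h))) hB hc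

lemma condMutualInfo_auxiliary_congr
    (h : IsJoint w (P.prod circleNoise) (fun z => z.1 Finset.univ) μ D X Y)
    (h' : IsJoint w' (P.prod circleNoise) (fun z => z.1 Finset.univ) μ D X Y') (hP : Coherent P)
    (he : MeasurableEmbedding e) (hc : Observes auxiliaryLeader e A c)
    (hc' : Observes auxiliaryLeader e A' c') {i i' : Fin 4} (hA : ¬ A ⊆ {0, 1})
    (hA' : ¬ A' ⊆ {0, 1}) (hB : A ∪ {i} = B) (hB' : A' ∪ {i'} = B')
    (heq : meanEntropy w P A - meanEntropy w P B = meanEntropy w' P A' - meanEntropy w' P B') :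
    condMutualInfo μ (auxiliary e D i) Y (fun ω => c (D ω)) =
      condMutualInfo μ (auxiliary e D i') Y' (fun ω => c' (D ω)) := by
  rw [condMutualInfo_auxiliary h hP he hc i hA hB, condMutualInfo_auxiliary h' hP he hc' i' hA' hB',
    heq]

lemma condMutualInfo_auxiliary_add
    (h : IsJoint w (P.prod circleNoise) (fun z => z.1 Finset.univ) μ D X Y)
    (h' : IsJoint w' (P.prod circleNoise) (fun z => z.1 Finset.univ) μ D X Y') (hP : Coherent P)
    (he : MeasurableEmbedding e) (hc : Observes auxiliaryLeader e A c)
    (hc' : Observes auxiliaryLeader e A' c') {i i' : Fin 4} (hA : ¬ A ⊆ {0, 1})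
    (hA' : ¬ A' ⊆ {0, 1}) (hB : A ∪ {i} = B) (hB' : A' ∪ {i'} = B') :
    condMutualInfo μ (auxiliary e D i) Y (fun ω => c (D ω)) +
        condMutualInfo μ (auxiliary e D i') Y' (fun ω => c' (D ω)) =
      ENNReal.ofReal (meanEntropy w P A - meanEntropy w P B +
        (meanEntropy w' P A' - meanEntropy w' P B')) := by
  have hleader : ∀ {S T : Finset (Fin 4)} {j}, ¬ S ⊆ {0, 1} → S ∪ {j} = T →
      auxiliaryLeader T ∈ T := fun hS hT =>
    auxiliaryLeader_mem fun h => hS (Finset.subset_union_left.trans (hT.subset.trans h))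
  rw [condMutualInfo_auxiliary h hP he hc i hA hB, condMutualInfo_auxiliary h' hP he hc' i' hA' hB',
    ENNReal.ofReal_add
      (sub_nonneg.2 (meanEntropy_le h hP he (auxiliaryLeader_mem hA) (hleader hA hB) hB hc))
      (sub_nonneg.2 (meanEntropy_le h' hP he (auxiliaryLeader_mem hA') (hleader hA' hB') hB' hc'))]

lemma condMutualInfo_auxiliary_message_diff {𝒴₁ 𝒴₂ : Type*} [Fintype 𝒴₁] [Nonempty 𝒴₁]
    [MeasurableSpace 𝒴₁] [MeasurableSingletonClass 𝒴₁] [Fintype 𝒴₂] [Nonempty 𝒴₂]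
    [MeasurableSpace 𝒴₂] [MeasurableSingletonClass 𝒴₂] {p : 𝒳 → PMF (𝒴₁ × 𝒴₂)} {R : ℝ × ℝ}
    {Y : Ω → 𝒴₁ × 𝒴₂} (h : IsJoint p (P.prod circleNoise) (fun z => z.1 Finset.univ) μ D X Y)
    (hP : ApproxAdmissible p R 0 P) (he : MeasurableEmbedding e) :
    condMutualInfo μ (auxiliary e D 0) (fun ω => (Y ω).1)
          (fun ω => (auxiliary e D 1 ω, auxiliary e D 2 ω, auxiliary e D 3 ω)) +
        condMutualInfo μ (auxiliary e D 0) (fun ω => (Y ω).2)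
          (fun ω => (auxiliary e D 2 ω, auxiliary e D 3 ω)) =
      condMutualInfo μ (auxiliary e D 0) (fun ω => (Y ω).2)
          (fun ω => (auxiliary e D 1 ω, auxiliary e D 2 ω, auxiliary e D 3 ω)) +
        condMutualInfo μ (auxiliary e D 0) (fun ω => (Y ω).1)
          (fun ω => (auxiliary e D 2 ω, auxiliary e D 3 ω)) := by
  have hW : Observes auxiliaryLeader e {2, 3} _ := (observes_party 2).prodMk (observes_party 3)
  have hVW : Observes auxiliaryLeader e {1, 2, 3} _ := (observes_party 1).prodMk hW
  rw [condMutualInfo_auxiliary_add (h.comp measurable_fst) (h.comp measurable_snd) hP.coherent he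
      hVW hW (B := {0, 1, 2, 3}) (B' := {0, 2, 3}) (by decide) (by decide) (by decide) (by decide),
    condMutualInfo_auxiliary_add (h.comp measurable_snd) (h.comp measurable_fst) hP.coherent he
      hVW hW (B := {0, 1, 2, 3}) (B' := {0, 2, 3}) (by decide) (by decide) (by decide) (by decide)]
  exact congrArg ENNReal.ofReal hP.message_diff

end Realization

section Admissible

variable {𝒳 𝒴₁ 𝒴₂ Ω : Type*} [Fintype 𝒳] [Nonempty 𝒳] [MeasurableSpace 𝒳]
  [MeasurableSingletonClass 𝒳] [Fintype 𝒴₁] [Nonempty 𝒴₁] [MeasurableSpace 𝒴₁]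
  [MeasurableSingletonClass 𝒴₁] [Fintype 𝒴₂] [Nonempty 𝒴₂] [MeasurableSpace 𝒴₂]
  [MeasurableSingletonClass 𝒴₂] [MeasurableSpace Ω] {p : 𝒳 → PMF (𝒴₁ × 𝒴₂)} {R : ℝ × ℝ}
  {P : Measure (Posteriors (Fin 4) 𝒳)} [IsProbabilityMeasure P] {μ : Measure Ω}
  [IsProbabilityMeasure μ] {X : Ω → 𝒳} {Y : Ω → 𝒴₁ × 𝒴₂}
  {D : Ω → Posteriors (Fin 4) 𝒳 × (Fin 4 → Finset (Fin 4) → UnitAddCircle)}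
  {e : stdSimplex ℝ 𝒳 → UnitAddCircle}

lemma condMutualInfo_messages
    (h : IsJoint p (P.prod circleNoise) (fun z => z.1 Finset.univ) μ D X Y)
    (hP : ApproxAdmissible p R 0 P) (he : MeasurableEmbedding e) :
    condMutualInfo μ (auxiliary e D 0) (auxiliary e D 1)
        (fun ω => (auxiliary e D 2 ω, auxiliary e D 3 ω, (Y ω).1)) =
      condMutualInfo μ (auxiliary e D 0) (auxiliary e D 1)
        (fun ω => (auxiliary e D 2 ω, auxiliary e D 3 ω, (Y ω).2)) := by
  have hU : ∀ i, Measurable (auxiliary e D i) := fun i =>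
    ((observes_party i).measurable he.measurable).comp h.measurable_D
  have hW := (hU 2).prodMk (hU 3)
  have oW : Observes auxiliaryLeader e {2, 3} _ := (observes_party 2).prodMk (observes_party 3)
  have h₁ := h.comp measurable_fst
  have h₂ := h.comp measurable_snd
  have hfinite₁ := condMutualInfo_auxiliary h₁ hP.coherent he oW 0 (by decide) rfl
  have hfinite₂ := condMutualInfo_auxiliary h₂ hP.coherent he oW 0 (by decide) rfl
  have hcongr := condMutualInfo_prodMk_congr_of_diff (hU 0) (hU 1) hW
    h₁.measurable_Y h₂.measurable_Y (hfinite₁.trans_ne ENNReal.ofReal_ne_top)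
    (hfinite₂.trans_ne ENNReal.ofReal_ne_top) ?_
  · rw [← condMutualInfo_comp_measurableEquiv (hU 0) (hU 1)
        (hW.prodMk h₁.measurable_Y) MeasurableEquiv.prodAssoc,
      ← condMutualInfo_comp_measurableEquiv (hU 0) (hU 1)
        (hW.prodMk h₂.measurable_Y) MeasurableEquiv.prodAssoc] at hcongr
    exact hcongr
  · rw [← condMutualInfo_comp_measurableEquiv (hU 0) h₁.measurable_Y (hW.prodMk (hU 1))
        MeasurableEquiv.prodComm,
      ← condMutualInfo_comp_measurableEquiv (hU 0) h₂.measurable_Y (hW.prodMk (hU 1))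
        MeasurableEquiv.prodComm]
    exact condMutualInfo_auxiliary_message_diff h hP he

lemma isAdmissible_auxiliary
    (h : IsJoint p (P.prod circleNoise) (fun z => z.1 Finset.univ) μ D X Y)
    (hP : ApproxAdmissible p R 0 P) (he : MeasurableEmbedding e) :
    IsAdmissible p μ (auxiliary e D 0) (auxiliary e D 1) (auxiliary e D 2) (auxiliary e D 3) X
      (fun ω => (Y ω).1) (fun ω => (Y ω).2) := by
  have hparty : ∀ i, Measurable (party auxiliaryLeader e i) := fun i =>
    (observes_party i).measurable he.measurable
  have hm : ∀ i, Measurable (auxiliary e D i) := fun i => (hparty i).comp h.measurable_D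
  have h₁ := h.comp measurable_fst
  have h₂ := h.comp measurable_snd
  have o := observes_party (leader := auxiliaryLeader) (e := e)
  refine ⟨hm 0, hm 1, hm 2, hm 3, h.measurable_X, h₁.measurable_Y, h₂.measurable_Y,
    fun B hB x y => ?_, ?_, ?_, ?_, condMutualInfo_messages h hP he, ?_, ?_, ?_, ?_,
    condMutualInfo_auxiliary_message_diff h hP he⟩
  · have hpre : MeasurableSet ((fun z => (party auxiliaryLeader e 0 z, party auxiliaryLeader e 1 z,
        party auxiliaryLeader e 2 z, party auxiliaryLeader e 3 z)) ⁻¹' B) :=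
      ((hparty 0).prodMk ((hparty 1).prodMk ((hparty 2).prodMk (hparty 3)))) hB
    have := h.measure_inter_singleton hpre x y
    rw [Set.inter_assoc] at this
    exact this
  · exact indepFun_comp_measurePreserving (h.measurePreserving (by fun_prop)) (hparty 0)
      (hparty 1) (indepFun_party (by decide) (ne_auxiliaryLeader (by decide))
        (ne_auxiliaryLeader (by decide)) P)
  · exact condMutualInfo_auxiliary_congr h₁ h₁ hP.coherent he (o 2) ((o 1).prodMk (o 2))
      (B := {0, 2}) (B' := {0, 1, 2}) (by decide) (by decide) (by decide) (by decide)
      (sub_eq_zero.1 (abs_nonpos_iff.1 hP.abs_fst_le))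
  · exact condMutualInfo_auxiliary_congr h₂ h₂ hP.coherent he (o 3) ((o 0).prodMk (o 3))
      (B := {1, 3}) (B' := {0, 1, 3}) (by decide) (by decide) (by decide) (by decide)
      (sub_eq_zero.1 (abs_nonpos_iff.1 hP.abs_snd_le))
  · exact condMutualInfo_auxiliary_congr h₁ h₂ hP.coherent he (o 2) (o 3)
      (B := {2, 3}) (B' := {2, 3}) (by decide) (by decide) (by decide) (by decide)
      (hP.sum_identity ∅ (by decide))
  · exact condMutualInfo_auxiliary_congr h₁ h₂ hP.coherent he ((o 0).prodMk (o 2))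
      ((o 0).prodMk (o 3)) (B := {0, 2, 3}) (B' := {0, 2, 3}) (by decide) (by decide)
      (by decide) (by decide) (hP.sum_identity {0} (by decide))
  · exact condMutualInfo_auxiliary_congr h₁ h₂ hP.coherent he ((o 1).prodMk (o 2))
      ((o 1).prodMk (o 3)) (B := {1, 2, 3}) (B' := {1, 2, 3}) (by decide) (by decide)
      (by decide) (by decide) (hP.sum_identity {1} (by decide))
  · exact condMutualInfo_auxiliary_congr h₁ h₂ hP.coherent he
      ((o 0).prodMk ((o 1).prodMk (o 2))) ((o 0).prodMk ((o 1).prodMk (o 3)))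
      (B := {0, 1, 2, 3}) (B' := {0, 1, 2, 3}) (by decide) (by decide)
      (by decide) (by decide) (hP.sum_identity {0, 1} (by decide))

theorem ApproxAdmissible.mem_outerRegion (hP : ApproxAdmissible p R 0 P) : R ∈ outerRegion p := by
  obtain ⟨e, he⟩ := exists_measurableEmbedding_circle (stdSimplex ℝ 𝒳)
  have : ∀ _ : Fin 4, StandardBorelSpace (Finset (Fin 4) → UnitAddCircle) := fun _ => inferInstance
  have : StandardBorelSpace (Fin 4 → Finset (Fin 4) → UnitAddCircle) :=
    StandardBorelSpace.pi_countable
  obtain ⟨μ, D, X, Y, h⟩ := exists_isJoint p (P.prod circleNoise) fun z => z.1 Finset.univ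
  have hD := h.measurePreserving (by fun_prop)
  have : IsProbabilityMeasure (μ.map D) := hD.map_eq ▸ inferInstance
  have hμ := Measure.isProbabilityMeasure_of_map (μ := μ) D
  refine ⟨ℝ, inferInstance, μ, hμ, _, _, _, _, X, _, _, isAdmissible_auxiliary h hP he, ?_, ?_⟩
  · rw [condMutualInfo_auxiliary (h.comp measurable_fst) hP.coherent he (observes_party 2) 0
      (B := {0, 2}) (by decide) (by decide)]
    exact ENNReal.ofReal_le_ofReal (by simpa using hP.rate_fst_le)
  · rw [condMutualInfo_auxiliary (h.comp measurable_snd) hP.coherent he (observes_party 3) 1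
      (B := {1, 3}) (by decide) (by decide)]
    exact ENNReal.ofReal_le_ofReal (by simpa using hP.rate_snd_le)

end Admissible

/-! ### Entropy on a finite probability space -/

section FiniteEntropy

open Classical in
/-- The sum of `g` over the fibre of `f` through `ω`. The probability of this fibre is the case
`g = q`, where `q` is the probability mass function. -/
def fiberSum {Ω τ : Type*} [Fintype Ω] (f : Ω → τ) (g : Ω → ℝ) (ω : Ω) : ℝ :=
  ∑ ω' with f ω' = f ω, g ω'

/-- The conditional probability of `B = b` given the value of `f` at `ω`; it is `0` when this value
has probability `0`. -/
def condProb {Ω τ β : Type*} [Fintype Ω] (q : Ω → ℝ) (f : Ω → τ) (B : Ω → β) (ω : Ω) (b : β) : ℝ :=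
  fiberSum f ({ω' | B ω' = b}.indicator q) ω / fiberSum f q ω

/-- The entropy (in nats) of `f` for the probability mass function `q`. -/
def entropy {Ω τ : Type*} [Fintype Ω] (q : Ω → ℝ) (f : Ω → τ) : ℝ :=
  -∑ ω, q ω * Real.log (fiberSum f q ω)

variable {Ω τ σ β : Type*} [Fintype Ω] {q : Ω → ℝ} {f : Ω → τ} {f' : Ω → σ} {B : Ω → β}

lemma fiberSum_congr (h : ∀ ω ω', f ω = f ω' ↔ f' ω = f' ω') : fiberSum f = fiberSum f' := by
  classical
  funext g ω
  exact Finset.sum_congr (Finset.filter_congr fun ω' _ => h ω' ω) fun _ _ => rfl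

lemma entropy_congr (h : ∀ ω ω', f ω = f ω' ↔ f' ω = f' ω') : entropy q f = entropy q f' := by
  rw [entropy, entropy, fiberSum_congr h]

lemma factorsThrough_fiberSum (f : Ω → τ) (g : Ω → ℝ) : (fiberSum f g).FactorsThrough f := by
  intro ω ω' h
  rw [fiberSum, fiberSum, h]

lemma factorsThrough_condProb (q : Ω → ℝ) (f : Ω → τ) (B : Ω → β) :
    (condProb q f B).FactorsThrough f := by
  intro ω ω' h
  funext b
  rw [condProb, condProb, factorsThrough_fiberSum f _ h, factorsThrough_fiberSum f _ h]

lemma fiberSum_nonneg {g : Ω → ℝ} (hg : ∀ ω, 0 ≤ g ω) (ω : Ω) : 0 ≤ fiberSum f g ω :=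
  Finset.sum_nonneg fun ω' _ => hg ω'

lemma condProb_nonneg (hq : ∀ ω, 0 ≤ q ω) (ω : Ω) (b : β) : 0 ≤ condProb q f B ω b :=
  div_nonneg (fiberSum_nonneg (fun ω' => Set.indicator_nonneg (fun _ _ => hq _) ω') ω)
    (fiberSum_nonneg hq ω)

lemma fiberSum_pos (hq : ∀ ω, 0 ≤ q ω) {ω : Ω} (h : q ω ≠ 0) : 0 < fiberSum f q ω := by
  classical
  exact ((hq ω).lt_of_ne' h).trans_le
    (Finset.single_le_sum (fun ω' _ => hq ω') (by simp))

lemma sum_condProb [Fintype β] {ω : Ω} (h : fiberSum f q ω ≠ 0) :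
    ∑ b, condProb q f B ω b = 1 := by
  classical
  simp only [condProb, ← Finset.sum_div]
  rw [div_eq_one_iff_eq h]
  simp only [fiberSum]
  rw [Finset.sum_comm]
  exact Finset.sum_congr rfl fun ω' _ => by simp [Set.indicator_apply]

lemma sum_fiberSum_mul (f : Ω → τ) (g k : Ω → ℝ) :
    ∑ ω, fiberSum f g ω * k ω = ∑ ω, g ω * fiberSum f k ω := by
  classical
  simp only [fiberSum, Finset.sum_filter, Finset.sum_mul, Finset.mul_sum, ite_mul, mul_ite,
    zero_mul, mul_zero]
  rw [Finset.sum_comm]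
  simp only [eq_comm]

lemma fiberSum_mul {G : Ω → ℝ} (hG : G.FactorsThrough f) (g : Ω → ℝ) (ω : Ω) :
    fiberSum f (fun ω' => g ω' * G ω') ω = fiberSum f g ω * G ω := by
  classical
  rw [fiberSum, fiberSum, Finset.sum_mul]
  exact Finset.sum_congr rfl fun ω' hω' => by rw [hG (Finset.mem_filter.1 hω').2]

lemma sum_mul_condProb_mul (hq : ∀ ω, 0 ≤ q ω) (B : Ω → β) (b : β) {G : Ω → ℝ}
    (hG : G.FactorsThrough f) :
    ∑ ω, q ω * (condProb q f B ω b * G ω) = ∑ ω, {ω' | B ω' = b}.indicator q ω * G ω := by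
  have hG' : (fun ω => G ω / fiberSum f q ω).FactorsThrough f := fun ω ω' h => by
    simp only [hG h, factorsThrough_fiberSum f q h]
  calc ∑ ω, q ω * (condProb q f B ω b * G ω)
      = ∑ ω, fiberSum f ({ω' | B ω' = b}.indicator q) ω * (q ω * (G ω / fiberSum f q ω)) :=
        Finset.sum_congr rfl fun ω _ => by rw [condProb]; ring
    _ = ∑ ω, {ω' | B ω' = b}.indicator q ω * (fiberSum f q ω * (G ω / fiberSum f q ω)) := by
        simp only [sum_fiberSum_mul, fiberSum_mul hG']
    _ = ∑ ω, {ω' | B ω' = b}.indicator q ω * G ω := by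
        refine Finset.sum_congr rfl fun ω _ => ?_
        by_cases h : q ω = 0
        · simp [h]
        · rw [mul_div_cancel₀ _ (fiberSum_pos hq h).ne']

lemma sum_mul_sum_condProb_mul [Fintype β] (hq : ∀ ω, 0 ≤ q ω) (B : Ω → β) {G : Ω → β → ℝ}
    (hG : G.FactorsThrough f) :
    ∑ ω, q ω * ∑ b, condProb q f B ω b * G ω b = ∑ ω, q ω * G ω (B ω) := by
  classical
  simp only [Finset.mul_sum]
  rw [Finset.sum_comm, Finset.sum_congr rfl fun b _ => sum_mul_condProb_mul hq B b
    (G := fun ω => G ω b) fun ω ω' h => congrFun (hG h) b, Finset.sum_comm]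
  exact Finset.sum_congr rfl fun ω _ => by simp [Set.indicator_apply]

lemma sum_mul_sum_negMulLog_condProb [Fintype β] (hq : ∀ ω, 0 ≤ q ω) (B : Ω → β) :
    ∑ ω, q ω * ∑ b, Real.negMulLog (condProb q f B ω b) =
      entropy q (fun ω => (f ω, B ω)) - entropy q f := by
  have hjoint (ω : Ω) :
      fiberSum f ({ω' | B ω' = B ω}.indicator q) ω = fiberSum (fun ω => (f ω, B ω)) q ω := by
    classical
    simp only [fiberSum, Prod.mk.injEq, ← Finset.filter_filter, Finset.sum_filter _ q,
      Set.indicator_apply, Set.mem_ofPred_eq]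
  simp only [Real.negMulLog, neg_mul, ← mul_neg]
  rw [sum_mul_sum_condProb_mul hq B (G := fun ω b => -Real.log (condProb q f B ω b))
    fun ω ω' h => by simp only [factorsThrough_condProb q f B h], entropy, entropy,
    sub_neg_eq_add, ← Finset.sum_neg_distrib, ← Finset.sum_add_distrib]
  refine Finset.sum_congr rfl fun ω _ => ?_
  by_cases h : q ω = 0
  · simp [h]
  rw [condProb, hjoint, Real.log_div (fiberSum_pos hq h).ne' (fiberSum_pos hq h).ne']
  ring

lemma entropy_le_of_factorsThrough (hq : ∀ ω, 0 ≤ q ω) (h : f.FactorsThrough f') :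
    entropy q f ≤ entropy q f' := by
  classical
  rw [entropy, entropy, neg_le_neg_iff]
  refine Finset.sum_le_sum fun ω _ => ?_
  by_cases h0 : q ω = 0
  · simp [h0]
  refine mul_le_mul_of_nonneg_left (Real.log_le_log (fiberSum_pos hq h0) ?_) (hq ω)
  exact Finset.sum_le_sum_of_subset_of_nonneg
    (Finset.monotone_filter_right _ fun _ _ h' => h h') fun ω' _ _ => hq ω'

lemma sum_negMulLog_le_sum_mul_neg_log [Fintype β] {k e : β → ℝ} (hk : ∀ b, 0 ≤ k b)
    (he : ∀ b, 0 < e b) (hsum : ∑ b, e b = ∑ b, k b) :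
    ∑ b, Real.negMulLog (k b) ≤ ∑ b, k b * -Real.log (e b) := by
  have h := sum_klFun_div_add_sum_negMulLog hk (fun b => (he b).le)
    fun b hb => absurd hb (he b).ne'
  have hdiv : 0 ≤ ∑ b, klFun (k b / e b) * e b := Finset.sum_nonneg fun b _ =>
    mul_nonneg (klFun_nonneg (div_nonneg (hk b) (he b).le)) (he b).le
  linarith

lemma entropy_prodMk_sub_le_crossEntropy [Fintype β] (hq : ∀ ω, 0 ≤ q ω) (B : Ω → β) {Q : Ω → β → ℝ}
    (hQ : Q.FactorsThrough f) (hQ0 : ∀ ω b, 0 < Q ω b) (hQ1 : ∀ ω, ∑ b, Q ω b = 1) :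
    entropy q (fun ω => (f ω, B ω)) - entropy q f ≤ ∑ ω, q ω * -Real.log (Q ω (B ω)) := by
  rw [← sum_mul_sum_negMulLog_condProb hq, ← sum_mul_sum_condProb_mul (f := f) hq B
    (G := fun ω b => -Real.log (Q ω b)) fun ω ω' h => by simp only [hQ h]]
  refine Finset.sum_le_sum fun ω _ => ?_
  by_cases h : q ω = 0
  · simp [h]
  · exact mul_le_mul_of_nonneg_left (sum_negMulLog_le_sum_mul_neg_log (condProb_nonneg hq ω)
      (hQ0 ω) ((hQ1 ω).trans (sum_condProb (fiberSum_pos hq h).ne').symm)) (hq ω)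

open Classical in
lemma fano_inequality [Fintype β] [Nonempty β] (hq : ∀ ω, 0 ≤ q ω) (hq1 : ∑ ω, q ω = 1)
    (B : Ω → β) {D : Ω → β} (hD : D.FactorsThrough f) :
    entropy q (fun ω => (f ω, B ω)) - entropy q f ≤
      Real.log 2 + (∑ ω with D ω ≠ B ω, q ω) * Real.log (Fintype.card β) := by
  have hcard : (0 : ℝ) < Fintype.card β := by exact_mod_cast Fintype.card_pos
  -- half of the mass on the guess `D`, the other half uniform
  let Q : Ω → β → ℝ := fun ω b => (if D ω = b then 1 / 2 else 0) + 1 / (2 * Fintype.card β)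
  have hQ0 (ω : Ω) (b : β) : 0 < Q ω b :=
    add_pos_of_nonneg_of_pos (by split_ifs <;> norm_num) (by positivity)
  have hQ1 (ω : Ω) : ∑ b, Q ω b = 1 := by
    simp only [Q, Finset.sum_add_distrib, Finset.sum_ite_eq, Finset.mem_univ, if_true,
      Finset.sum_const, Finset.card_univ, nsmul_eq_mul]
    field_simp
    norm_num
  have hlog (ω : Ω) : -Real.log (Q ω (B ω)) ≤
      Real.log 2 + if D ω ≠ B ω then Real.log (Fintype.card β) else 0 := by
    by_cases h : D ω = B ω
    · rw [if_neg (not_not.2 h), add_zero, neg_le, ← Real.log_inv, inv_eq_one_div]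
      refine Real.log_le_log one_half_pos ?_
      simp only [Q, if_pos h]
      exact le_add_of_nonneg_right (by positivity)
    · simp only [Q, if_pos h, if_neg h, zero_add, one_div, Real.log_inv, neg_neg]
      rw [Real.log_mul two_ne_zero hcard.ne']
  calc entropy q (fun ω => (f ω, B ω)) - entropy q f
      ≤ ∑ ω, q ω * -Real.log (Q ω (B ω)) :=
        entropy_prodMk_sub_le_crossEntropy hq B (fun ω ω' h => by simp only [Q, hD h]) hQ0 hQ1
    _ ≤ ∑ ω, q ω * (Real.log 2 + if D ω ≠ B ω then Real.log (Fintype.card β) else 0) :=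
        Finset.sum_le_sum fun ω _ => mul_le_mul_of_nonneg_left (hlog ω) (hq ω)
    _ = _ := by
        simp only [mul_add, mul_ite, mul_zero, Finset.sum_add_distrib, ← Finset.sum_mul, hq1,
          one_mul, ← Finset.sum_filter]

end FiniteEntropy

/-! ### Finitely supported posteriors -/

section Posterior

variable {Ω τ σ 𝒳 : Type*} [Fintype Ω] [Fintype 𝒳] [Nonempty 𝒳]

open Classical in
/-- The conditional distribution of `X` given the value of `f` at `ω`, with an arbitrary choice when
this value has probability `0`. -/
def posterior (q : Ω → ℝ) (hq : ∀ ω, 0 ≤ q ω) (f : Ω → τ) (X : Ω → 𝒳) (ω : Ω) :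
    stdSimplex ℝ 𝒳 :=
  if h : fiberSum f q ω = 0 then Classical.arbitrary _
  else ⟨condProb q f X ω, condProb_nonneg hq ω, sum_condProb h⟩

variable {q : Ω → ℝ} {hq : ∀ ω, 0 ≤ q ω} {f : Ω → τ} {f' : Ω → σ} {X : Ω → 𝒳}

lemma posterior_apply {ω : Ω} (h : q ω ≠ 0) (x : 𝒳) :
    posterior q hq f X ω x = condProb q f X ω x := by
  rw [posterior, dif_neg (fiberSum_pos hq h).ne']
  rfl

lemma factorsThrough_posterior (q : Ω → ℝ) (hq : ∀ ω, 0 ≤ q ω) (f : Ω → τ) (X : Ω → 𝒳) :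
    (posterior q hq f X).FactorsThrough f := by
  intro ω ω' h
  unfold posterior
  simp only [factorsThrough_fiberSum f q h, factorsThrough_condProb q f X h]

lemma sum_mul_posterior_mul (x : 𝒳) {G : Ω → ℝ} (hG : G.FactorsThrough f) :
    ∑ ω, q ω * (posterior q hq f X ω x * G ω) = ∑ ω, {ω' | X ω' = x}.indicator q ω * G ω := by
  rw [← sum_mul_condProb_mul hq X x hG]
  refine Finset.sum_congr rfl fun ω _ => ?_
  by_cases h : q ω = 0
  · simp [h]
  · rw [posterior_apply h]

end Posterior

section FiniteLaw

variable {T E : Type*} [Fintype T] [MeasurableSpace E]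

/-- The distribution of `κ` when `a` is the probability mass function on the finite type `T`. -/
def finiteLaw (a : T → ℝ) (κ : T → E) : Measure E :=
  ∑ t, ENNReal.ofReal (a t) • Measure.dirac (κ t)

lemma isProbabilityMeasure_finiteLaw {a : T → ℝ} (ha : ∀ t, 0 ≤ a t) (ha1 : ∑ t, a t = 1)
    (κ : T → E) : IsProbabilityMeasure (finiteLaw a κ) :=
  ⟨by simp [finiteLaw, ← ENNReal.ofReal_sum_of_nonneg fun t _ => ha t, ha1]⟩

lemma integral_finiteLaw [MeasurableSingletonClass E] {a : T → ℝ} (ha : ∀ t, 0 ≤ a t) (κ : T → E)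
    (g : E → ℝ) : ∫ x, g x ∂(finiteLaw a κ) = ∑ t, a t * g (κ t) := by
  rw [finiteLaw, integral_finsetSum_measure fun t _ =>
    (integrable_dirac (by simp)).smul_measure ENNReal.ofReal_ne_top]
  refine Finset.sum_congr rfl fun t _ => ?_
  rw [integral_smul_measure, integral_dirac, ENNReal.toReal_ofReal (ha t), smul_eq_mul]

end FiniteLaw

/-! ### The distribution induced by a code -/

section Memoryless

variable {ι 𝒴 R : Type*} [Fintype ι] [DecidableEq ι] [Fintype 𝒴] [CommSemiring R]

lemma sum_prod_mul_eq_mul_sum {r : ι → 𝒴 → R} (i : ι) (hr : ∑ b, r i b = 1) {G : (ι → 𝒴) → R}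
    (hG : ∀ y b, G (Function.update y i b) = G y) (g : 𝒴 → R) :
    ∑ y : ι → 𝒴, (∏ j, r j (y j)) * (G y * g (y i)) =
      (∑ b, r i b * g b) * ∑ y : ι → 𝒴, (∏ j, r j (y j)) * G y := by
  -- exchange coordinate `i` with an independent copy of it
  let exchange : (ι → 𝒴) × 𝒴 → (ι → 𝒴) × 𝒴 := fun z => (Function.update z.1 i z.2, z.1 i)
  have hexchange : Function.Involutive exchange := fun z => by simp [exchange]
  have hprod (y : ι → 𝒴) (b : 𝒴) :
      (∏ j, r j (Function.update y i b j)) * r i (y i) = (∏ j, r j (y j)) * r i b := by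
    rw [← Finset.mul_prod_erase _ _ (Finset.mem_univ i),
      ← Finset.mul_prod_erase _ (fun j => r j (y j)) (Finset.mem_univ i), Function.update_self,
      Finset.prod_congr rfl fun j hj => by rw [Function.update_of_ne (Finset.ne_of_mem_erase hj)]]
    ring
  calc ∑ y : ι → 𝒴, (∏ j, r j (y j)) * (G y * g (y i))
      = ∑ z : (ι → 𝒴) × 𝒴, (∏ j, r j (z.1 j)) * r i z.2 * (G z.1 * g (z.1 i)) := by
        simp only [Fintype.sum_prod_type, ← Finset.sum_mul, ← Finset.mul_sum, hr, mul_one]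
    _ = ∑ z : (ι → 𝒴) × 𝒴, (∏ j, r j (z.1 j)) * r i z.2 * (G z.1 * g z.2) := by
        rw [← Equiv.sum_comp (hexchange.toPerm exchange)]
        refine Finset.sum_congr rfl fun z _ => ?_
        simp only [Function.Involutive.coe_toPerm, exchange, hprod, hG, Function.update_self]
    _ = (∑ b, r i b * g b) * ∑ y : ι → 𝒴, (∏ j, r j (y j)) * G y := by
        rw [Finset.sum_mul_sum, Finset.sum_comm, ← Fintype.sum_prod_type']
        exact Finset.sum_congr rfl fun z _ => by ring

end Memoryless

section CodeLaw

lemma sum_toReal_pmf {β : Type*} [Fintype β] (q : PMF β) : ∑ b, (q b).toReal = 1 := by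
  have h := q.tsum_coe
  rw [tsum_fintype] at h
  rw [← ENNReal.toReal_sum fun b _ => q.apply_ne_top b, h, ENNReal.toReal_one]

lemma toReal_map_apply {α β : Type*} [Fintype α] (q : PMF α) (f : α → β) (b : β) :
    (q.map f b).toReal = ∑ a, (q a).toReal * {a' | f a' = b}.indicator 1 a := by
  classical
  rw [PMF.map_apply, tsum_fintype, ENNReal.toReal_sum fun a _ => by
    split_ifs <;> simp [q.apply_ne_top]]
  refine Finset.sum_congr rfl fun a _ => ?_
  by_cases h : f a = b
  · simp [h]
  · simp [h, Ne.symm h]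

variable {𝒳 𝒴₁ 𝒴₂ : Type*} {n M₁ M₂ : ℕ}

/-- The messages and the channel outputs. -/
abbrev Outcome (𝒴₁ 𝒴₂ : Type*) (n M₁ M₂ : ℕ) : Type _ :=
  Fin M₁ × Fin M₂ × (Fin n → 𝒴₁ × 𝒴₂)

/-- The input at time `i`. -/
def Code.input (c : Code 𝒳 𝒴₁ 𝒴₂ n M₁ M₂) (i : Fin n) (ω : Outcome 𝒴₁ 𝒴₂ n M₁ M₂) : 𝒳 :=
  c.enc ω.1 ω.2.1 i

/-- The probability of an outcome when the code is used with independent uniform messages. -/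
def Code.prob (c : Code 𝒳 𝒴₁ 𝒴₂ n M₁ M₂) (p : 𝒳 → PMF (𝒴₁ × 𝒴₂))
    (ω : Outcome 𝒴₁ 𝒴₂ n M₁ M₂) : ℝ :=
  (∏ j, (p (c.input j ω) (ω.2.2 j)).toReal) / (M₁ * M₂)

/-- The message that the first receiver decodes. -/
def Code.guess₁ (c : Code 𝒳 𝒴₁ 𝒴₂ n M₁ M₂) (ω : Outcome 𝒴₁ 𝒴₂ n M₁ M₂) : Fin M₁ :=
  c.dec₁ fun j => (ω.2.2 j).1

/-- The message that the second receiver decodes. -/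
def Code.guess₂ (c : Code 𝒳 𝒴₁ 𝒴₂ n M₁ M₂) (ω : Outcome 𝒴₁ 𝒴₂ n M₁ M₂) : Fin M₂ :=
  c.dec₂ fun j => (ω.2.2 j).2

variable (c : Code 𝒳 𝒴₁ 𝒴₂ n M₁ M₂) (p : 𝒳 → PMF (𝒴₁ × 𝒴₂))

lemma Code.prob_nonneg (ω : Outcome 𝒴₁ 𝒴₂ n M₁ M₂) : 0 ≤ c.prob p ω :=
  div_nonneg (Finset.prod_nonneg fun _ _ => ENNReal.toReal_nonneg) (by positivity)

lemma Code.prob_div_nonneg (t : Fin n × Outcome 𝒴₁ 𝒴₂ n M₁ M₂) : 0 ≤ c.prob p t.2 / n :=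
  div_nonneg (c.prob_nonneg p t.2) n.cast_nonneg

variable [Fintype 𝒴₁] [Fintype 𝒴₂]

lemma Code.sum_prob_mul (F : Outcome 𝒴₁ 𝒴₂ n M₁ M₂ → ℝ) :
    ∑ ω, c.prob p ω * F ω = (∑ m₁, ∑ m₂, ∑ y : Fin n → 𝒴₁ × 𝒴₂,
      (∏ j, (p (c.enc m₁ m₂ j) (y j)).toReal) * F (m₁, m₂, y)) / (M₁ * M₂) := by
  simp only [Fintype.sum_prod_type, Finset.sum_div, Code.prob, Code.input, div_mul_eq_mul_div]

lemma Code.sum_prob_mul_messages (F : Fin M₁ → Fin M₂ → ℝ) :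
    ∑ ω, c.prob p ω * F ω.1 ω.2.1 = (∑ m₁, ∑ m₂, F m₁ m₂) / (M₁ * M₂) := by
  have h (m₁ : Fin M₁) (m₂ : Fin M₂) :
      ∑ y : Fin n → 𝒴₁ × 𝒴₂, ∏ j, (p (c.enc m₁ m₂ j) (y j)).toReal = 1 := by
    rw [← Fintype.prod_sum fun j y => (p (c.enc m₁ m₂ j) y).toReal]
    simp only [sum_toReal_pmf, Finset.prod_const_one]
  rw [c.sum_prob_mul p fun ω => F ω.1 ω.2.1]
  simp only [← Finset.sum_mul, h, one_mul]

lemma Code.sum_prob [NeZero M₁] [NeZero M₂] : ∑ ω, c.prob p ω = 1 := by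
  have h := c.sum_prob_mul_messages p fun _ _ => 1
  simp only [mul_one, Finset.sum_const, Finset.card_univ, Fintype.card_fin, nsmul_eq_mul] at h
  rw [h, div_self (mul_ne_zero (NeZero.ne _) (NeZero.ne _))]

lemma Code.errorProb_eq_sum_prob :
    c.errorProb p = ∑ ω with c.guess₁ ω ≠ ω.1 ∨ c.guess₂ ω ≠ ω.2.1, c.prob p ω := by
  have h := c.sum_prob_mul p fun ω => if c.guess₁ ω ≠ ω.1 ∨ c.guess₂ ω ≠ ω.2.1 then 1 else 0
  simp only [mul_ite, mul_one, mul_zero] at h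
  rw [Finset.sum_filter, h]
  rfl

lemma Code.sum_prob_mul_output {β : Type*} (f : 𝒴₁ × 𝒴₂ → β) (i : Fin n) (b : β)
    {G : Outcome 𝒴₁ 𝒴₂ n M₁ M₂ → ℝ}
    (hG : ∀ m₁ m₂ y y₀, G (m₁, m₂, Function.update y i y₀) = G (m₁, m₂, y)) :
    ∑ ω, c.prob p ω * (G ω * {y | f y = b}.indicator 1 (ω.2.2 i)) =
      ∑ ω, c.prob p ω * (((p (c.input i ω)).map f b).toReal * G ω) := by
  rw [c.sum_prob_mul p, c.sum_prob_mul p]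
  congr 1
  refine Finset.sum_congr rfl fun m₁ _ => Finset.sum_congr rfl fun m₂ _ => ?_
  rw [sum_prod_mul_eq_mul_sum (r := fun j y => (p (c.enc m₁ m₂ j) y).toReal) i
    (sum_toReal_pmf _) (G := fun y => G (m₁, m₂, y)) (hG m₁ m₂), ← toReal_map_apply, Finset.mul_sum]
  exact Finset.sum_congr rfl fun y _ => mul_left_comm _ _ _

end CodeLaw

/-! ### The posteriors of a code -/

lemma entropy_eq_log_of_fiberSum_eq {Ω τ : Type*} [Fintype Ω] {q : Ω → ℝ} {f : Ω → τ} {a : ℝ}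
    (hq1 : ∑ ω, q ω = 1) (h : ∀ ω, fiberSum f q ω = a⁻¹) : entropy q f = Real.log a := by
  simp only [entropy, h, ← Finset.sum_mul, hq1, one_mul, Real.log_inv, neg_neg]

section View

variable {𝒴₁ 𝒴₂ : Type*} {n M₁ M₂ : ℕ}

/-- The messages selected by `J` (`0` selects the first message and `1` the second one), the outputs
of the first receiver before time `a` and those of the second receiver from time `b` on. -/
def view (J : Finset (Fin 4)) (a b : ℕ) (ω : Outcome 𝒴₁ 𝒴₂ n M₁ M₂) :
    Option (Fin M₁) × Option (Fin M₂) × (Fin n → Option 𝒴₁) × (Fin n → Option 𝒴₂) :=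
  (if 0 ∈ J then some ω.1 else none, if 1 ∈ J then some ω.2.1 else none,
    fun j => if j.val < a then some (ω.2.2 j).1 else none,
    fun j => if b ≤ j.val then some (ω.2.2 j).2 else none)

lemma view_eq_iff {J : Finset (Fin 4)} {a b : ℕ} {ω ω' : Outcome 𝒴₁ 𝒴₂ n M₁ M₂} :
    view J a b ω = view J a b ω' ↔ (0 ∈ J → ω.1 = ω'.1) ∧ (1 ∈ J → ω.2.1 = ω'.2.1) ∧
      (∀ j : Fin n, j.val < a → (ω.2.2 j).1 = (ω'.2.2 j).1) ∧
      (∀ j : Fin n, b ≤ j.val → (ω.2.2 j).2 = (ω'.2.2 j).2) := by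
  simp only [view, Prod.mk.injEq, funext_iff]
  refine and_congr ?_ (and_congr ?_ (and_congr (forall_congr' fun j => ?_)
    (forall_congr' fun j => ?_))) <;> split_ifs with h <;> simp [h]

/-- What the parties in `S` know at time `i`: party `0` knows the first message, party `1` the
second one, party `2` the past of the first output and party `3` the future of the second one. -/
def label (i : Fin n) (S : Finset (Fin 4)) (ω : Outcome 𝒴₁ 𝒴₂ n M₁ M₂) :
    Option (Fin M₁) × Option (Fin M₂) × (Fin n → Option 𝒴₁) × (Fin n → Option 𝒴₂) :=
  view S (if 2 ∈ S then i else 0) (if 3 ∈ S then i + 1 else n) ω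

lemma label_update (i : Fin n) (S : Finset (Fin 4)) (m₁ : Fin M₁) (m₂ : Fin M₂)
    (y : Fin n → 𝒴₁ × 𝒴₂) (y₀ : 𝒴₁ × 𝒴₂) :
    label i S (m₁, m₂, Function.update y i y₀) = label i S (m₁, m₂, y) := by
  refine view_eq_iff.2 ⟨fun _ => rfl, fun _ => rfl, fun j hj => ?_, fun j hj => ?_⟩ <;>
  · have : j ≠ i := by
      rintro rfl
      split_ifs at hj <;> omega
    simp only [Function.update_of_ne this]

lemma factorsThrough_label {S A : Finset (Fin 4)} (hSA : S ⊆ A) (i : Fin n) :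
    (label (𝒴₁ := 𝒴₁) (𝒴₂ := 𝒴₂) (M₁ := M₁) (M₂ := M₂) i S).FactorsThrough (label i A) := by
  intro ω ω' h
  obtain ⟨h₀, h₁, h₂, h₃⟩ := view_eq_iff.1 h
  refine view_eq_iff.2 ⟨fun h => h₀ (hSA h), fun h => h₁ (hSA h), fun j hj => h₂ j ?_,
    fun j hj => h₃ j ?_⟩
  · by_cases hS : 2 ∈ S
    · simpa only [hS, hSA hS] using hj
    · simp [hS] at hj
  · by_cases hS : 3 ∈ S
    · simpa only [hS, hSA hS] using hj
    · rw [if_neg hS] at hj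
      exact absurd j.2 hj.not_gt

end View

section ViewEntropy

variable {𝒳 𝒴₁ 𝒴₂ : Type*} {n M₁ M₂ : ℕ} [Fintype 𝒴₁] [Fintype 𝒴₂]
  (c : Code 𝒳 𝒴₁ 𝒴₂ n M₁ M₂) (p : 𝒳 → PMF (𝒴₁ × 𝒴₂))

/-- The entropy of the view of the messages in `J`, of the outputs of the first receiver before time
`a` and of those of the second receiver from time `b` on. -/
def Code.viewEntropy (J : Finset (Fin 4)) (a b : ℕ) : ℝ := entropy (c.prob p) (view J a b)

lemma Code.fiberSum_view_messages [NeZero M₁] [NeZero M₂] (J : Finset (Fin 4))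
    (ω : Outcome 𝒴₁ 𝒴₂ n M₁ M₂) : fiberSum (view J 0 n) (c.prob p) ω =
      ((if 0 ∈ J then (M₁ : ℝ) else 1) * if 1 ∈ J then (M₂ : ℝ) else 1)⁻¹ := by
  classical
  have hview (ω' : Outcome 𝒴₁ 𝒴₂ n M₁ M₂) : view J 0 n ω' = view J 0 n ω ↔
      (0 ∈ J → ω'.1 = ω.1) ∧ (1 ∈ J → ω'.2.1 = ω.2.1) := by
    rw [view_eq_iff]
    exact ⟨fun h => ⟨h.1, h.2.1⟩, fun h => ⟨h.1, h.2, fun j hj => absurd hj (by omega),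
      fun j hj => absurd j.2 (by omega)⟩⟩
  calc fiberSum (view J 0 n) (c.prob p) ω
      = ∑ ω', c.prob p ω' * ((if 0 ∈ J → ω'.1 = ω.1 then 1 else 0) *
          if 1 ∈ J → ω'.2.1 = ω.2.1 then 1 else 0) := by
        simp only [ite_zero_mul_ite_zero]
        simp only [fiberSum, Finset.sum_filter, hview, mul_ite, mul_one, mul_zero]
    _ = (∑ m₁, if 0 ∈ J → m₁ = ω.1 then 1 else 0) *
          (∑ m₂, if 1 ∈ J → m₂ = ω.2.1 then 1 else 0) / (M₁ * M₂) := by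
        rw [c.sum_prob_mul_messages p fun m₁ m₂ => (if 0 ∈ J → m₁ = ω.1 then 1 else 0) *
          if 1 ∈ J → m₂ = ω.2.1 then 1 else 0, Finset.sum_mul_sum]
    _ = _ := by
        have hM₁ : (M₁ : ℝ) ≠ 0 := NeZero.ne _
        have hM₂ : (M₂ : ℝ) ≠ 0 := NeZero.ne _
        by_cases h0 : 0 ∈ J <;> by_cases h1 : 1 ∈ J <;>
          simp [h0, h1, hM₁, hM₂, div_mul_cancel_left₀, div_mul_cancel_right₀, mul_comm]

lemma Code.viewEntropy_messages [NeZero M₁] [NeZero M₂] (J : Finset (Fin 4)) :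
    c.viewEntropy p J 0 n =
      (if 0 ∈ J then Real.log M₁ else 0) + if 1 ∈ J then Real.log M₂ else 0 := by
  rw [Code.viewEntropy,
    entropy_eq_log_of_fiberSum_eq (c.sum_prob p) (c.fiberSum_view_messages p J), Real.log_mul]
  · split_ifs <;> simp
  · split_ifs <;> simp [NeZero.ne M₁]
  · split_ifs <;> simp [NeZero.ne M₂]

lemma Code.entropy_sub_entropy_mem_Icc [NeZero M₁] [NeZero M₂] {τ σ ℳ : Type*} [Fintype ℳ]
    [Nonempty ℳ] {f : Outcome 𝒴₁ 𝒴₂ n M₁ M₂ → τ} {f' : Outcome 𝒴₁ 𝒴₂ n M₁ M₂ → σ}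
    {M D : Outcome 𝒴₁ 𝒴₂ n M₁ M₂ → ℳ} (hf' : ∀ ω ω', f' ω = f' ω' ↔ f ω = f ω' ∧ M ω = M ω')
    (hD : D.FactorsThrough f)
    (herror : ∀ ω, D ω ≠ M ω → c.guess₁ ω ≠ ω.1 ∨ c.guess₂ ω ≠ ω.2.1) :
    entropy (c.prob p) f' - entropy (c.prob p) f ∈
      Set.Icc 0 (Real.log 2 + c.errorProb p * Real.log (Fintype.card ℳ)) := by
  classical
  have hpair : entropy (c.prob p) f' = entropy (c.prob p) fun ω => (f ω, M ω) :=
    entropy_congr fun ω ω' => by rw [hf', Prod.mk.injEq]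
  refine ⟨sub_nonneg.2 (entropy_le_of_factorsThrough (c.prob_nonneg p) fun ω ω' h =>
    ((hf' ω ω').1 h).1), ?_⟩
  rw [hpair, c.errorProb_eq_sum_prob]
  refine (fano_inequality (c.prob_nonneg p) (c.sum_prob p) M hD).trans ?_
  gcongr
  · exact fun _ _ _ => c.prob_nonneg p _
  · exact herror _

lemma Code.viewEntropy_insert_zero_mem_Icc [NeZero M₁] [NeZero M₂] (J : Finset (Fin 4)) :
    c.viewEntropy p (insert 0 J) n n - c.viewEntropy p J n n ∈
      Set.Icc 0 (Real.log 2 + c.errorProb p * Real.log M₁) := by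
  suffices h : _ ∈ Set.Icc 0 (Real.log 2 + c.errorProb p * Real.log (Fintype.card (Fin M₁))) by
    simpa only [Fintype.card_fin] using h
  refine c.entropy_sub_entropy_mem_Icc p (M := fun ω => ω.1) (D := c.guess₁) (fun ω ω' => ?_)
    (fun ω ω' h => ?_) fun ω => Or.inl
  · simp only [view_eq_iff, Finset.mem_insert, true_or, true_imp_iff, one_ne_zero, false_or]
    tauto
  · exact congrArg c.dec₁ (funext fun j => (view_eq_iff.1 h).2.2.1 j j.2)

lemma Code.viewEntropy_insert_one_mem_Icc [NeZero M₁] [NeZero M₂] (J : Finset (Fin 4)) :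
    c.viewEntropy p (insert 1 J) 0 0 - c.viewEntropy p J 0 0 ∈
      Set.Icc 0 (Real.log 2 + c.errorProb p * Real.log M₂) := by
  suffices h : _ ∈ Set.Icc 0 (Real.log 2 + c.errorProb p * Real.log (Fintype.card (Fin M₂))) by
    simpa only [Fintype.card_fin] using h
  refine c.entropy_sub_entropy_mem_Icc p (M := fun ω => ω.2.1) (D := c.guess₂) (fun ω ω' => ?_)
    (fun ω ω' h => ?_) fun ω => Or.inr
  · simp only [view_eq_iff, Finset.mem_insert, true_or, true_imp_iff, zero_ne_one, false_or]
    tauto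
  · exact congrArg c.dec₂ (funext fun j => (view_eq_iff.1 h).2.2.2 j j.1.zero_le)

end ViewEntropy

section CodePosteriors

variable {𝒳 𝒴₁ 𝒴₂ : Type*} {n M₁ M₂ : ℕ} [Fintype 𝒳] [Fintype 𝒴₁] [Fintype 𝒴₂]
  (c : Code 𝒳 𝒴₁ 𝒴₂ n M₁ M₂) (p : 𝒳 → PMF (𝒴₁ × 𝒴₂))

lemma Code.condProb_output {β τ : Type*} (f : 𝒴₁ × 𝒴₂ → β) (i : Fin n) (b : β)
    {Z : Outcome 𝒴₁ 𝒴₂ n M₁ M₂ → τ}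
    (hZ : ∀ m₁ m₂ y y₀, Z (m₁, m₂, Function.update y i y₀) = Z (m₁, m₂, y))
    (ω : Outcome 𝒴₁ 𝒴₂ n M₁ M₂) :
    condProb (c.prob p) Z (fun ω' => f (ω'.2.2 i)) ω b =
      outputProb (fun x => (p x).map f) (condProb (c.prob p) Z (c.input i) ω) b := by
  classical
  have h := c.sum_prob_mul_output p f i b (G := {ω' | Z ω' = Z ω}.indicator 1)
    fun m₁ m₂ y y₀ => by simp only [Set.indicator_apply, Set.mem_ofPred_eq, hZ, Pi.one_apply]
  simp only [condProb, outputProb, div_mul_eq_mul_div, ← Finset.sum_div]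
  congr 1
  simp only [fiberSum, Finset.sum_filter, Finset.sum_mul]
  rw [Finset.sum_comm]
  refine Eq.trans (Finset.sum_congr rfl fun ω' _ => ?_) (h.trans (Finset.sum_congr rfl
    fun ω' _ => ?_))
  · by_cases hz : Z ω' = Z ω <;> simp [hz, Set.indicator_apply]
  · by_cases hz : Z ω' = Z ω <;> simp [hz, Set.indicator_apply]

variable [Nonempty 𝒳]

/-- The posteriors of the input at time `i` given what the sets of parties know. -/
def Code.posteriors (i : Fin n) (ω : Outcome 𝒴₁ 𝒴₂ n M₁ M₂) : Posteriors (Fin 4) 𝒳 :=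
  fun S => posterior (c.prob p) (c.prob_nonneg p) (label i S) (c.input i) ω

/-- The distribution of the posteriors at a uniformly distributed time. -/
def Code.law : Measure (Posteriors (Fin 4) 𝒳) :=
  finiteLaw (fun t : Fin n × Outcome 𝒴₁ 𝒴₂ n M₁ M₂ => c.prob p t.2 / n)
    fun t => c.posteriors p t.1 t.2

lemma Code.isProbabilityMeasure_law [NeZero n] [NeZero M₁] [NeZero M₂] :
    IsProbabilityMeasure (c.law p) := by
  have h1 : ∑ t : Fin n × Outcome 𝒴₁ 𝒴₂ n M₁ M₂, c.prob p t.2 / n = 1 := by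
    rw [Fintype.sum_prod_type]
    simp only [← Finset.sum_div, c.sum_prob p, Finset.sum_const, Finset.card_univ,
      Fintype.card_fin, nsmul_eq_mul]
    exact (mul_div_assoc _ _ _).trans (mul_one_div_cancel (NeZero.ne (n : ℝ)))
  exact isProbabilityMeasure_finiteLaw (c.prob_div_nonneg p) h1 _

lemma Code.integral_law (g : Posteriors (Fin 4) 𝒳 → ℝ) :
    ∫ κ, g κ ∂(c.law p) = (∑ i, ∑ ω, c.prob p ω * g (c.posteriors p i ω)) / n := by
  rw [Code.law, integral_finiteLaw (c.prob_div_nonneg p), Fintype.sum_prod_type]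
  simp only [div_mul_eq_mul_div, ← Finset.sum_div]

lemma Code.coherent_law [IsFiniteMeasure (c.law p)] : Coherent (c.law p) := by
  refine coherent_iff_integral_eq.2 fun A x g => ?_
  rw [c.integral_law p, c.integral_law p]
  congr 1
  refine Finset.sum_congr rfl fun i _ => ?_
  have hforget {B : Finset (Fin 4)} (hAB : A ⊆ B) :
      (fun ω => g (forget A (c.posteriors p i ω))).FactorsThrough (label i B) := by
    intro ω ω' h
    refine congrArg g (funext fun S => ?_)
    unfold forget
    split_ifs with hS
    · exact factorsThrough_posterior _ _ _ _ (factorsThrough_label (hS.trans hAB) i h)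
    · rfl
  exact (sum_mul_posterior_mul x (hforget (Finset.subset_univ A))).trans
    (sum_mul_posterior_mul x (hforget subset_rfl)).symm

lemma Code.meanEntropy_law {β : Type*} [Fintype β] (f : 𝒴₁ × 𝒴₂ → β) (S : Finset (Fin 4)) :
    meanEntropy (fun x => (p x).map f) (c.law p) S =
      (∑ i, (entropy (c.prob p) (fun ω => (label i S ω, f (ω.2.2 i))) -
        entropy (c.prob p) (label i S))) / n := by
  rw [meanEntropy, c.integral_law p]
  congr 1
  refine Finset.sum_congr rfl fun i _ => ?_
  rw [← sum_mul_sum_negMulLog_condProb (c.prob_nonneg p) fun ω => f (ω.2.2 i)]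
  refine Finset.sum_congr rfl fun ω _ => ?_
  by_cases h : c.prob p ω = 0
  · simp [h]
  simp only [outEntropy, c.condProb_output p f i _ (label_update i S), outputProb, Code.posteriors,
    posterior_apply h]

lemma Code.meanEntropy₁_law {S J : Finset (Fin 4)} (h2 : 2 ∈ S) (h0 : 0 ∈ S ↔ 0 ∈ J)
    (h1 : 1 ∈ S ↔ 1 ∈ J) : meanEntropy₁ p (c.law p) S =
      (∑ i ∈ Finset.range n, (c.viewEntropy p J (i + 1) (if 3 ∈ S then i + 1 else n) -
        c.viewEntropy p J i (if 3 ∈ S then i + 1 else n))) / n := by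
  rw [meanEntropy₁, c.meanEntropy_law p, ← Fin.sum_univ_eq_sum_range (fun i =>
    c.viewEntropy p J (i + 1) (if 3 ∈ S then i + 1 else n) -
      c.viewEntropy p J i (if 3 ∈ S then i + 1 else n))]
  congr 1
  refine Finset.sum_congr rfl fun i _ => congrArg₂ _ (entropy_congr fun ω ω' => ?_)
    (entropy_congr fun ω ω' => ?_)
  · simp only [Prod.mk.injEq, label, view_eq_iff, if_pos h2, h0, h1]
    refine ⟨fun ⟨⟨hm₁, hm₂, hpast, hfuture⟩, hnow⟩ => ⟨hm₁, hm₂, fun j hj => ?_, hfuture⟩,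
      fun ⟨hm₁, hm₂, hpast, hfuture⟩ =>
        ⟨⟨hm₁, hm₂, fun j hj => hpast j (by omega), hfuture⟩, hpast i (by omega)⟩⟩
    rcases Nat.lt_succ_iff_lt_or_eq.1 hj with hj | hj
    · exact hpast j hj
    · rwa [Fin.ext hj]
  · simp only [label, view_eq_iff, if_pos h2, h0, h1]

lemma Code.meanEntropy₂_law {S J : Finset (Fin 4)} (h3 : 3 ∈ S) (h0 : 0 ∈ S ↔ 0 ∈ J)
    (h1 : 1 ∈ S ↔ 1 ∈ J) : meanEntropy₂ p (c.law p) S =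
      (∑ i ∈ Finset.range n, (c.viewEntropy p J (if 2 ∈ S then i else 0) i -
        c.viewEntropy p J (if 2 ∈ S then i else 0) (i + 1))) / n := by
  rw [meanEntropy₂, c.meanEntropy_law p, ← Fin.sum_univ_eq_sum_range (fun i =>
    c.viewEntropy p J (if 2 ∈ S then i else 0) i -
      c.viewEntropy p J (if 2 ∈ S then i else 0) (i + 1))]
  congr 1
  refine Finset.sum_congr rfl fun i _ => congrArg₂ _ (entropy_congr fun ω ω' => ?_)
    (entropy_congr fun ω ω' => ?_)
  · simp only [Prod.mk.injEq, label, view_eq_iff, if_pos h3, h0, h1]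
    refine ⟨fun ⟨⟨hm₁, hm₂, hpast, hfuture⟩, hnow⟩ => ⟨hm₁, hm₂, hpast, fun j hj => ?_⟩,
      fun ⟨hm₁, hm₂, hpast, hfuture⟩ =>
        ⟨⟨hm₁, hm₂, hpast, fun j hj => hfuture j (by omega)⟩, hfuture i le_rfl⟩⟩
    rcases Nat.lt_or_eq_of_le hj with hj | hj
    · exact hfuture j hj
    · rwa [← Fin.ext hj]
  · simp only [label, view_eq_iff, if_pos h3, h0, h1]

lemma Code.meanEntropy₁_law_past {J : Finset (Fin 4)} (hJ : J ⊆ {0, 1}) :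
    meanEntropy₁ p (c.law p) (J ∪ {2}) =
      (c.viewEntropy p J n n - c.viewEntropy p J 0 n) / n := by
  have h3 : 3 ∉ J ∪ {2} := fun h => absurd (Finset.union_subset_union_left hJ h) (by decide)
  rw [c.meanEntropy₁_law p (J := J) (by simp) (by simp) (by simp)]
  simp only [h3, if_false, Finset.sum_range_sub (fun i => c.viewEntropy p J i n)]

lemma Code.meanEntropy₂_law_future {J : Finset (Fin 4)} (hJ : J ⊆ {0, 1}) :
    meanEntropy₂ p (c.law p) (J ∪ {3}) =
      (c.viewEntropy p J 0 0 - c.viewEntropy p J 0 n) / n := by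
  have h2 : 2 ∉ J ∪ {3} := fun h => absurd (Finset.union_subset_union_left hJ h) (by decide)
  rw [c.meanEntropy₂_law p (J := J) (by simp) (by simp) (by simp)]
  simp only [h2, if_false, Finset.sum_range_sub' (fun i => c.viewEntropy p J 0 i)]

/-- Csiszár's sum identity, for `H a b` the entropy of the outputs of the first receiver before time
`a` and of those of the second receiver from time `b` on. -/
lemma sum_range_sub_sum_range_diagonal {A : Type*} [AddCommGroup A] (H : ℕ → ℕ → A) (n : ℕ) :
    H n n - H 0 n - ∑ i ∈ Finset.range n, (H (i + 1) (i + 1) - H i (i + 1)) =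
      H 0 0 - H 0 n - ∑ i ∈ Finset.range n, (H i i - H i (i + 1)) := by
  rw [sub_eq_sub_iff_sub_eq_sub, ← Finset.sum_sub_distrib]
  simp only [sub_sub_sub_cancel_right, Finset.sum_range_sub fun i => H i i]

lemma Code.meanEntropy_law_sum_identity {J : Finset (Fin 4)} (hJ : J ⊆ {0, 1}) :
    meanEntropy₁ p (c.law p) (J ∪ {2}) - meanEntropy₁ p (c.law p) (J ∪ {2, 3}) =
      meanEntropy₂ p (c.law p) (J ∪ {3}) - meanEntropy₂ p (c.law p) (J ∪ {2, 3}) := by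
  rw [c.meanEntropy₁_law_past p hJ, c.meanEntropy₂_law_future p hJ,
    c.meanEntropy₁_law p (S := J ∪ {2, 3}) (J := J) (by simp) (by simp) (by simp),
    c.meanEntropy₂_law p (S := J ∪ {2, 3}) (J := J) (by simp) (by simp) (by simp)]
  simp only [Finset.mem_union, Finset.mem_insert, Finset.mem_singleton, or_true, true_or, if_true,
    ← sub_div, sum_range_sub_sum_range_diagonal]

lemma Code.meanEntropy₁_law_sub_mem_Icc [NeZero M₁] [NeZero M₂] {J : Finset (Fin 4)}
    (hJ : J ⊆ {1}) :
    meanEntropy₁ p (c.law p) (J ∪ {2}) - meanEntropy₁ p (c.law p) (insert 0 J ∪ {2}) ∈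
      Set.Icc ((Real.log M₁ - (Real.log 2 + c.errorProb p * Real.log M₁)) / n)
        (Real.log M₁ / n) := by
  have h0 : 0 ∉ J := fun h => absurd (hJ h) (by decide)
  have hfano := c.viewEntropy_insert_zero_mem_Icc p J
  rw [c.meanEntropy₁_law_past p (hJ.trans (by decide)),
    c.meanEntropy₁_law_past p (Finset.insert_subset_insert 0 hJ), c.viewEntropy_messages,
    c.viewEntropy_messages, ← sub_div]
  simp only [h0, Finset.mem_insert, true_or, if_true, if_false, one_ne_zero, false_or]
  constructor <;>
    exact div_le_div_of_nonneg_right (by linarith [hfano.1, hfano.2]) n.cast_nonneg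

lemma Code.meanEntropy₂_law_sub_mem_Icc [NeZero M₁] [NeZero M₂] {J : Finset (Fin 4)}
    (hJ : J ⊆ {0}) :
    meanEntropy₂ p (c.law p) (J ∪ {3}) - meanEntropy₂ p (c.law p) (insert 1 J ∪ {3}) ∈
      Set.Icc ((Real.log M₂ - (Real.log 2 + c.errorProb p * Real.log M₂)) / n)
        (Real.log M₂ / n) := by
  have h1 : 1 ∉ J := fun h => absurd (hJ h) (by decide)
  have hfano := c.viewEntropy_insert_one_mem_Icc p J
  rw [c.meanEntropy₂_law_future p (hJ.trans (by decide)),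
    c.meanEntropy₂_law_future p ((Finset.insert_subset_insert 1 hJ).trans (by decide)),
    c.viewEntropy_messages, c.viewEntropy_messages, ← sub_div]
  simp only [h1, Finset.mem_insert, true_or, if_true, if_false, zero_ne_one, false_or]
  constructor <;>
    exact div_le_div_of_nonneg_right (by linarith [hfano.1, hfano.2]) n.cast_nonneg

end CodePosteriors

/-! ### Passing to the limit -/

section Limit

variable {𝒳 𝒴₁ 𝒴₂ : Type*} [Fintype 𝒳] [Nonempty 𝒳] [Fintype 𝒴₁] [Fintype 𝒴₂]
  {p : 𝒳 → PMF (𝒴₁ × 𝒴₂)}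

lemma Code.approxAdmissible_law {n M₁ M₂ : ℕ} [NeZero n] [NeZero M₁] [NeZero M₂]
    (c : Code 𝒳 𝒴₁ 𝒴₂ n M₁ M₂) {R : ℝ × ℝ} {η : ℝ}
    (h₁ : (Real.log 2 + c.errorProb p * Real.log M₁) / n ≤ η)
    (h₂ : (Real.log 2 + c.errorProb p * Real.log M₂) / n ≤ η)
    (hR₁ : R.1 ≤ (Real.log M₁ - (Real.log 2 + c.errorProb p * Real.log M₁)) / n + η)
    (hR₂ : R.2 ≤ (Real.log M₂ - (Real.log 2 + c.errorProb p * Real.log M₂)) / n + η) :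
    ApproxAdmissible p R η (c.law p) := by
  have := c.isProbabilityMeasure_law p
  have hgap {m ε a b : ℝ} (hε : ε / n ≤ η) (ha : a ∈ Set.Icc ((m - ε) / n) (m / n))
      (hb : b ∈ Set.Icc ((m - ε) / n) (m / n)) : |a - b| ≤ η := by
    rw [sub_div] at ha hb
    exact abs_le.2 ⟨by linarith [ha.1, hb.2], by linarith [ha.2, hb.1]⟩
  have hU := c.meanEntropy₁_law_sub_mem_Icc p (J := ∅) (by decide)
  have hUV := c.meanEntropy₁_law_sub_mem_Icc p (J := {1}) (by decide)
  have hV := c.meanEntropy₂_law_sub_mem_Icc p (J := ∅) (by decide)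
  have hVU := c.meanEntropy₂_law_sub_mem_Icc p (J := {0}) (by decide)
  rw [show insert 1 {0} ∪ {3} = ({0, 1, 3} : Finset (Fin 4)) by decide] at hVU
  exact ⟨c.coherent_law p, fun J hJ => c.meanEntropy_law_sum_identity p hJ, hgap h₁ hU hUV,
    hgap h₂ hV hVU, hR₁.trans (add_le_add_left hU.1 η), hR₂.trans (add_le_add_left hV.1 η)⟩

lemma tendsto_log_ceil_exp_mul_div {r : ℝ} (hr : 0 ≤ r) :
    Tendsto (fun n : ℕ => Real.log ⌈Real.exp (n * r)⌉₊ / n) atTop (𝓝 r) := by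
  have hlim : Tendsto (fun n : ℕ => r + Real.log 2 / n) atTop (𝓝 r) := by
    simpa only [add_zero] using
      tendsto_const_nhds.add (tendsto_const_div_atTop_nhds_zero_nat (Real.log 2))
  refine tendsto_of_tendsto_of_tendsto_of_le_of_le' tendsto_const_nhds hlim ?_ ?_
  · filter_upwards [eventually_gt_atTop 0] with n hn
    rw [le_div_iff₀ (Nat.cast_pos.2 hn), mul_comm]
    exact (Real.le_log_iff_exp_le (Nat.cast_pos.2 (Nat.ceil_pos.2 (Real.exp_pos _)))).2
      (Nat.le_ceil _)
  · filter_upwards [eventually_gt_atTop 0] with n hn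
    have hn : (0 : ℝ) < n := Nat.cast_pos.2 hn
    have hceil : (⌈Real.exp (n * r)⌉₊ : ℝ) ≤ Real.exp (n * r) * 2 := by
      linarith [Nat.ceil_lt_add_one (Real.exp_pos (n * r)).le,
        Real.one_le_exp (mul_nonneg hn.le hr)]
    calc Real.log ⌈Real.exp (n * r)⌉₊ / n ≤ Real.log (Real.exp (n * r) * 2) / n := by
          gcongr
      _ = r + Real.log 2 / n := by
          rw [Real.log_mul (Real.exp_pos _).ne' two_ne_zero, Real.log_exp, add_div,
            mul_div_cancel_left₀ _ hn.ne']

lemma Achievable.exists_approxAdmissible {R : ℝ × ℝ} (h : Achievable p R.1 R.2) {η : ℝ}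
    (hη : 0 < η) : ∃ P : ProbabilityMeasure (Posteriors (Fin 4) 𝒳), ApproxAdmissible p R η P := by
  obtain ⟨h₁, h₂, c, hc⟩ := h
  have hfano {r : ℝ} (hr : 0 ≤ r) : Tendsto (fun n : ℕ => (Real.log 2 +
      (c n).errorProb p * Real.log ⌈Real.exp (n * r)⌉₊) / n) atTop (𝓝 0) := by
    simpa only [add_div, mul_div_assoc, zero_mul, add_zero] using
      (tendsto_const_div_atTop_nhds_zero_nat (Real.log 2)).add
        (hc.mul (tendsto_log_ceil_exp_mul_div hr))
  have hrate {r : ℝ} (hr : 0 ≤ r) : Tendsto (fun n : ℕ => (Real.log ⌈Real.exp (n * r)⌉₊ -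
      (Real.log 2 + (c n).errorProb p * Real.log ⌈Real.exp (n * r)⌉₊)) / n) atTop (𝓝 r) := by
    simpa only [sub_div, sub_zero] using (tendsto_log_ceil_exp_mul_div hr).sub (hfano hr)
  have hrate_le {r : ℝ} (hr : 0 ≤ r) := (hrate hr).eventually_const_le (sub_lt_self r hη)
  obtain ⟨n, hn, a₁, a₂, b₁, b₂⟩ := ((eventually_gt_atTop 0).and
    (((hfano h₁).eventually_le_const hη).and (((hfano h₂).eventually_le_const hη).and
      ((hrate_le h₁).and (hrate_le h₂))))).exists
  have : NeZero n := ⟨hn.ne'⟩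
  have (r : ℝ) : NeZero ⌈Real.exp (n * r)⌉₊ := ⟨(Nat.ceil_pos.2 (Real.exp_pos _)).ne'⟩
  exact ⟨⟨(c n).law p, (c n).isProbabilityMeasure_law p⟩, (c n).approxAdmissible_law a₁ a₂
    (sub_le_iff_le_add.1 b₁) (sub_le_iff_le_add.1 b₂)⟩

lemma continuous_integral_probabilityMeasure {E : Type*} [TopologicalSpace E] [CompactSpace E]
    [MeasurableSpace E] [OpensMeasurableSpace E] {g : E → ℝ} (hg : Continuous g) :
    Continuous fun P : ProbabilityMeasure E => ∫ x, g x ∂P :=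
  ProbabilityMeasure.continuous_integral_boundedContinuousFunction
    (BoundedContinuousFunction.mkOfCompact ⟨g, hg⟩)

lemma isClosed_setOf_approxAdmissible :
    IsClosed {t : ProbabilityMeasure (Posteriors (Fin 4) 𝒳) × (ℝ × ℝ) × ℝ |
      ApproxAdmissible p t.2.1 t.2.2 t.1} := by
  have hintegral {g : Posteriors (Fin 4) 𝒳 → ℝ} (hg : Continuous g) :
      Continuous fun t : ProbabilityMeasure (Posteriors (Fin 4) 𝒳) × (ℝ × ℝ) × ℝ =>
        ∫ κ, g κ ∂t.1 := (continuous_integral_probabilityMeasure hg).comp continuous_fst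
  have h₁ (S : Finset (Fin 4)) : Continuous fun t : ProbabilityMeasure (Posteriors (Fin 4) 𝒳) ×
      (ℝ × ℝ) × ℝ => meanEntropy₁ p t.1 S := hintegral (continuous_outEntropy_posterior _ S)
  have h₂ (S : Finset (Fin 4)) : Continuous fun t : ProbabilityMeasure (Posteriors (Fin 4) 𝒳) ×
      (ℝ × ℝ) × ℝ => meanEntropy₂ p t.1 S := hintegral (continuous_outEntropy_posterior _ S)
  have hposterior (A B : Finset (Fin 4)) (x : 𝒳) (g : C(Posteriors (Fin 4) 𝒳, ℝ)) :=
    hintegral ((continuous_posterior_apply B x).mul (g.continuous.comp (continuous_forget A)))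
  refine isClosed_of_closure_subset fun t ht => ?_
  have hmem {C : Set (ProbabilityMeasure (Posteriors (Fin 4) 𝒳) × (ℝ × ℝ) × ℝ)} (hC : IsClosed C)
      (h : {t | ApproxAdmissible p t.2.1 t.2.2 t.1} ⊆ C) : t ∈ C := closure_minimal h hC ht
  exact {
    coherent := coherent_iff_integral_eq.2 fun A x g =>
      hmem (isClosed_eq (hposterior A _ x g) (hposterior A A x g))
        fun _ h => coherent_iff_integral_eq.1 h.coherent A x g
    sum_identity := fun J hJ => hmem (isClosed_eq ((h₁ _).sub (h₁ _)) ((h₂ _).sub (h₂ _)))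
      fun _ h => h.sum_identity J hJ
    abs_fst_le := hmem (isClosed_le (((h₁ _).sub (h₁ _)).sub ((h₁ _).sub (h₁ _))).abs
      continuous_snd.snd) fun _ h => h.abs_fst_le
    abs_snd_le := hmem (isClosed_le (((h₂ _).sub (h₂ _)).sub ((h₂ _).sub (h₂ _))).abs
      continuous_snd.snd) fun _ h => h.abs_snd_le
    rate_fst_le := hmem (isClosed_le continuous_snd.fst.fst
      (((h₁ _).sub (h₁ _)).add continuous_snd.snd)) fun _ h => h.rate_fst_le
    rate_snd_le := hmem (isClosed_le continuous_snd.fst.snd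
      (((h₂ _).sub (h₂ _)).add continuous_snd.snd)) fun _ h => h.rate_snd_le }

lemma exists_approxAdmissible_of_mem_capacityRegion {R : ℝ × ℝ} (hR : R ∈ capacityRegion p) :
    ∃ P : ProbabilityMeasure (Posteriors (Fin 4) 𝒳), ApproxAdmissible p R 0 P := by
  have hclosed := isClosedMap_snd_of_compactSpace _ (isClosed_setOf_approxAdmissible (p := p))
  have happrox (R' : ℝ × ℝ) (hR' : Achievable p R'.1 R'.2) (η : ℝ) (hη : 0 < η) :
      (R', η) ∈ Prod.snd '' {t : ProbabilityMeasure (Posteriors (Fin 4) 𝒳) × (ℝ × ℝ) × ℝ |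
        ApproxAdmissible p t.2.1 t.2.2 t.1} := by
    obtain ⟨P, hP⟩ := hR'.exists_approxAdmissible hη
    exact ⟨(P, R', η), hP, rfl⟩
  have hzero : (R, (0 : ℝ)) ∈ closure ({R' | Achievable p R'.1 R'.2} ×ˢ Set.Ioi 0) := by
    rw [closure_prod_eq, closure_Ioi]
    exact ⟨hR, Set.self_mem_Ici⟩
  obtain ⟨⟨P, _⟩, hP, rfl⟩ := closure_minimal (fun t ht => happrox t.1 ht.1 t.2 ht.2) hclosed hzero
  exact ⟨P, hP⟩

end Limit

end BroadcastChannel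

end

theorem lemma1 {𝒳 𝒴₁ 𝒴₂ : Type*}
    [Fintype 𝒳] [Nonempty 𝒳] [MeasurableSpace 𝒳] [MeasurableSingletonClass 𝒳]
    [Fintype 𝒴₁] [Nonempty 𝒴₁] [MeasurableSpace 𝒴₁] [MeasurableSingletonClass 𝒴₁]
    [Fintype 𝒴₂] [Nonempty 𝒴₂] [MeasurableSpace 𝒴₂] [MeasurableSingletonClass 𝒴₂]
    (p : 𝒳 → PMF (𝒴₁ × 𝒴₂)) :
    BroadcastChannel.capacityRegion p ⊆ BroadcastChannel.outerRegion p := by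
  intro R hR
  obtain ⟨P, hP⟩ := BroadcastChannel.exists_approxAdmissible_of_mem_capacityRegion hR
  exact hP.mem_outerRegion
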